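/- Let $\varepsilon,R\in\mathbb R$, $R\ge 0$, $\hat R=(R^2+\tfrac14\varepsilon^2)^{1/2}>0$. Let $\mathcal W=\mathcal W(\varepsilon)$ be the complex unital algebra generated by $a_\pm,b_\pm$ with $[a_-,a_+]=[b_-,b_+]=\varepsilon$ and every $a_\pm$ commuting with every $b_\pm$, with the antilinear anti-automorphism $\dagger$ given by $a_\pm^\dagger=a_\mp$, $b_\pm^\dagger=b_\mp$. Put $J_0=\tfrac12(a_+a_--b_+b_-)$, $J_+=a_+b_-$, $J_-=a_-b_+$, $K_0=\tfrac12(a_+a_-+b_+b_-+\varepsilon)$, $\mathrm{Ad}_T(w)=[T,w]$ and $\Delta=\mathrm{Ad}_{J_0}\mathrm{Ad}_{J_0}+\tfrac12\mathrm{Ad}_{J_+}\mathrm{Ad}_{J_-}+\tfrac12\mathrm{Ad}_{J_-}\mathrm{Ad}_{J_+}$. For $s,t,u,v\ge0$ let $S(s,t,u,v)$ be the sum of all distinct words with $s$ letters $a_-$, $t$ letters $a_+$, $u$ letters $b_-$ and $v$ letters $b_+$; these form a basis of $\mathcal W$. Let $\mathrm{tr}:\mathcal W\to\mathcal W$ be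 the linear map $\mathrm{tr}\,S(s,t,u,v)=2S(s-1,t-1,u,v)+2S(s,t,u-1,v-1)$ (terms with a negative index being $0$), and $\Psi=\ker(\mathrm{tr})$. Then $\mathcal W=\Psi\oplus\{w(K_0-\hat R):w\in\mathcal W\}$; let $\rho:\mathcal W\to\Psi$ be the projection onto the first summand. Let $\pi_0(w)\in\mathbb C$ be the coefficient of $1=S(0,0,0,0)$ in $w$, and $\|\zeta\|^2=\pi_0(\rho(\zeta^\dagger\zeta))$. Call $(n,r)$ admissible if $2n,\,n+r\in\mathbb Z$ and $|r|\le n$. For $(n,r)$ and $(n,m)$ admissible let $$P(n,r,m)=\varepsilon^{m-n}\Bigl(\tfrac{(n+m)!}{(2n)!\,(n-m)!}\Bigr)^{1/2}(\mathrm{Ad}_{J_-})^{n-m}\bigl(a_+^{n+r}b_-^{n-r}\bigr),$$ where for $\varepsilon=0$ the operator $\varepsilon^{-1}\mathrm{Ad}_{J_-}$ is replaced by its limit, the derivation $b_+\partial/\partial a_+-a_-\partial/\partial b_-$ of the commutative polynomial algebra $\mathcal W(0)$; put $P(n,r,m)=0$ for all other indices. **Theorem.** Let $(n,r_1)$ and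 $(n,r_2)$ be admissible and define $$\omega^{r_1r_2}_n(\xi)=\sum_{m=-n}^{n}\rho\bigl(P(n,r_2,m)^\dagger\,\xi\,P(n,r_1,m)\bigr)\qquad(\xi\in\Psi).$$ Then: 1. $\omega^{r_1r_2}_n$ maps $\Psi$ to $\Psi$. The operators $\mathrm{Ad}_{J_0},\mathrm{Ad}_{J_+},\mathrm{Ad}_{J_-},\Delta,\mathrm{Ad}_{K_0}$ map $\Psi$ to $\Psi$, and $\omega^{r_1r_2}_n$ commutes on $\Psi$ with the first four of them. 2. $\mathrm{Ad}_{K_0}\,\omega^{r_1r_2}_n(\xi)=\varepsilon(r_1-r_2)\,\omega^{r_1r_2}_n(\xi)+\omega^{r_1r_2}_n(\mathrm{Ad}_{K_0}\xi)$ for all $\xi\in\Psi$. 3. For every admissible $(n',r)$ there is a constant $c\in\mathbb C$ such that $\omega^{r_1r_2}_n(P(n',r,m))=c\,P(n',r+r_1-r_2,m)$ for all $m$ with $(n',m)$ admissible; in particular the left side is $0$ if $|r+r_1-r_2|>n'$. 4. For every $m$ with $(n,m)$ admissible, $\omega^{r_1r_2}_n(1)=\delta_{r_1r_2}(2n+1)\,\|P(n,r_1,m)\|^2$.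 -/

import Mathlib

namespace FuzzySphere

/-- The four generators `a₋, a₊, b₋, b₊`. -/
inductive Gen
  | aM | aP | bM | bP
  deriving DecidableEq

namespace Gen

instance : Fintype Gen := ⟨{aM, aP, bM, bP}, by intro x; cases x <;> decide⟩

/-- The conjugate letter: `a₋ ↔ a₊`, `b₋ ↔ b₊`. -/
def bar : Gen → Gen
  | aM => aP
  | aP => aM
  | bM => bP
  | bP => bM

/-- The sign in `[x, bar x] = ε * sgn x`. -/
def sgn : Gen → ℂ
  | aM => 1
  | aP => -1
  | bM => 1
  | bP => -1

theorem sum_eq {M : Type*} [AddCommMonoid M] (f : Gen → M) :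
    ∑ x, f x = f aM + f aP + f bM + f bP := by
  have : (Finset.univ : Finset Gen) = {aM, aP, bM, bP} := rfl
  rw [this, Finset.sum_insert (by decide), Finset.sum_insert (by decide),
    Finset.sum_insert (by decide), Finset.sum_singleton]
  simp only [add_assoc]

end Gen

open Gen

/-- The defining relations `[a₋, a₊] = ε`, `[b₋, b₊] = ε`, and every `a` commutes with every `b`. -/
inductive Rel (ε : ℝ) : FreeAlgebra ℂ Gen → FreeAlgebra ℂ Gen → Prop
  | aa : Rel ε (FreeAlgebra.ι ℂ aM * FreeAlgebra.ι ℂ aP - FreeAlgebra.ι ℂ aP * FreeAlgebra.ι ℂ aM)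
      (algebraMap ℂ _ (ε : ℂ))
  | bb : Rel ε (FreeAlgebra.ι ℂ bM * FreeAlgebra.ι ℂ bP - FreeAlgebra.ι ℂ bP * FreeAlgebra.ι ℂ bM)
      (algebraMap ℂ _ (ε : ℂ))
  | ab (x y : Gen) (hx : x = aM ∨ x = aP) (hy : y = bM ∨ y = bP) :
      Rel ε (FreeAlgebra.ι ℂ x * FreeAlgebra.ι ℂ y - FreeAlgebra.ι ℂ y * FreeAlgebra.ι ℂ x) 0

/-- The algebra `W(ε)`, the product of two Heisenberg-Weyl algebras. -/
def W (ε : ℝ) : Type := RingQuot (Rel ε)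

noncomputable instance (ε : ℝ) : Ring (W ε) := inferInstanceAs (Ring (RingQuot (Rel ε)))

noncomputable instance (ε : ℝ) : Algebra ℂ (W ε) :=
  inferInstanceAs (Algebra ℂ (RingQuot (Rel ε)))

/-- The quotient map from the free algebra. -/
noncomputable def quotMap (ε : ℝ) : FreeAlgebra ℂ Gen →ₐ[ℂ] W ε := RingQuot.mkAlgHom ℂ (Rel ε)

theorem quotMap_rel {ε : ℝ} {x y : FreeAlgebra ℂ Gen} (h : Rel ε x y) :
    quotMap ε x = quotMap ε y := RingQuot.mkAlgHom_rel ℂ h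

/-- The generators as elements of `W(ε)`. -/
noncomputable def gen (ε : ℝ) (x : Gen) : W ε :=
  quotMap ε (FreeAlgebra.ι ℂ x)

theorem gen_def (ε : ℝ) (x : Gen) :
    quotMap ε (FreeAlgebra.ι ℂ x) = gen ε x := rfl

theorem gen_comm (ε : ℝ) (x y : Gen) :
    gen ε x * gen ε y - gen ε y * gen ε x =
      if y = bar x then algebraMap ℂ (W ε) (ε * sgn x) else 0 := by
  have h1 := quotMap_rel (Rel.aa (ε := ε))
  have h2 := quotMap_rel (Rel.bb (ε := ε))
  have h3 := fun x y hx hy => quotMap_rel (Rel.ab (ε := ε) x y hx hy)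
  simp only [map_sub, map_mul, AlgHom.commutes, map_zero, gen_def] at h1 h2 h3
  have h3' : ∀ x y, (x = aM ∨ x = aP) → (y = bM ∨ y = bP) →
      gen ε y * gen ε x - gen ε x * gen ε y = 0 := fun x y hx hy => by
    rw [← neg_sub, h3 x y hx hy, neg_zero]
  have h1' : gen ε aP * gen ε aM - gen ε aM * gen ε aP = -algebraMap ℂ (W ε) ε := by
    rw [← neg_sub, h1]
  have h2' : gen ε bP * gen ε bM - gen ε bM * gen ε bP = -algebraMap ℂ (W ε) ε := by
    rw [← neg_sub, h2]
  cases x <;> cases y <;> simp [bar, sgn, h1, h2, h1', h2', h3, h3']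

/-- Algebra homomorphisms out of `W(ε)`. -/
noncomputable def liftW (ε : ℝ) {A : Type*} [Semiring A] [Algebra ℂ A] (f : Gen → A)
    (h : ∀ x y, Rel ε x y → FreeAlgebra.lift ℂ f x = FreeAlgebra.lift ℂ f y) : W ε →ₐ[ℂ] A :=
  RingQuot.liftAlgHom ℂ ⟨FreeAlgebra.lift ℂ f, fun {x y} hxy => h x y hxy⟩

theorem liftW_gen (ε : ℝ) {A : Type*} [Semiring A] [Algebra ℂ A] (f : Gen → A)
    (h : ∀ x y, Rel ε x y → FreeAlgebra.lift ℂ f x = FreeAlgebra.lift ℂ f y) (x : Gen) :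
    liftW ε f h (gen ε x) = f x := by
  have := RingQuot.liftAlgHom_mkAlgHom_apply (S := ℂ) (FreeAlgebra.lift ℂ f)
    (fun {x y} hxy => h x y hxy) (FreeAlgebra.ι ℂ x)
  rw [FreeAlgebra.lift_ι_apply] at this
  exact this

theorem W_induction (ε : ℝ) {p : W ε → Prop} (w : W ε)
    (scal : ∀ c : ℂ, p (algebraMap ℂ (W ε) c)) (g : ∀ x, p (gen ε x))
    (mul : ∀ u v, p u → p v → p (u * v)) (add : ∀ u v, p u → p v → p (u + v)) : p w := by
  obtain ⟨v, rfl⟩ : ∃ v, quotMap ε v = w := RingQuot.mkAlgHom_surjective ℂ (Rel ε) w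
  induction v using FreeAlgebra.induction with
  | grade0 c => rw [AlgHom.commutes]; exact scal c
  | grade1 x => exact g x
  | mul a b ha hb => rw [map_mul]; exact mul _ _ ha hb
  | add a b ha hb => rw [map_add]; exact add _ _ ha hb

/-! ### Symmetric polynomials -/

/-- The sum, with coefficient one, of all words of length `N` in the letters `g x` in which every
letter `x` occurs exactly `d x` times (hence zero if some `d x` is negative). -/
noncomputable def symSum {A : Type*} [Ring A] (g : Gen → A) (N : ℕ) (d : Gen → ℤ) : A :=
  ∑ f : Fin N → Gen,
    if ∀ x, ((Finset.univ.filter fun i => f i = x).card : ℤ) = d x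
    then (List.ofFn fun i => g (f i)).prod else 0

theorem symSum_zero {A : Type*} [Ring A] (g : Gen → A) (d : Gen → ℤ) :
    symSum g 0 d = if d = 0 then 1 else 0 := by
  simp [symSum, funext_iff, eq_comm]

theorem symSum_succ {A : Type*} [Ring A] (g : Gen → A) (N : ℕ) (d : Gen → ℤ) :
    symSum g (N + 1) d = ∑ y, symSum g N (d - Pi.single y 1) * g y := by
  have key : ∀ (y : Gen) (f : Fin N → Gen) (x : Gen),
      (((Finset.univ.filter fun i : Fin (N + 1) =>
        Fin.snoc (α := fun _ => Gen) f y i = x).card : ℕ) : ℤ) =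
      ((Finset.univ.filter fun i => f i = x).card : ℤ) + (Pi.single y 1 : Gen → ℤ) x := by
    intro y f x
    rw [Finset.card_filter, Fin.sum_univ_castSucc, Finset.card_filter]
    simp [Pi.single_apply, eq_comm]
  unfold symSum
  rw [← (Fin.snocEquiv (fun _ : Fin (N + 1) => Gen)).sum_comp, Fintype.sum_prod_type]
  refine Finset.sum_congr rfl fun y _ => ?_
  rw [Finset.sum_mul]
  refine Finset.sum_congr rfl fun f _ => ?_
  simp only [Fin.snocEquiv, Equiv.coe_fn_mk, Pi.sub_apply]
  rw [ite_mul, zero_mul]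
  refine if_congr (forall_congr' fun x => ?_) ?_ rfl
  · rw [eq_sub_iff_add_eq]
    exact iff_of_eq (congrArg (· = d x) (key y f x))
  rw [List.ofFn_succ']
  simp

theorem symSum_map {A B : Type*} [Ring A] [Ring B] (φ : A →+* B) (g : Gen → A) (N : ℕ)
    (d : Gen → ℤ) : φ (symSum g N d) = symSum (fun x => φ (g x)) N d := by
  simp [symSum, apply_ite φ, map_list_prod, List.map_ofFn, Function.comp_def]

/-- `S(s,t,u,v)`: the totally symmetric polynomial with `s = d aM`, `t = d aP`, `u = d bM`,
`v = d bP`; it is zero if one of these is negative. -/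
noncomputable def S (ε : ℝ) (d : Gen → ℤ) : W ε := symSum (gen ε) (∑ x, d x).toNat d

theorem symSum_eq_zero {A : Type*} [Ring A] (g : Gen → A) (N : ℕ) (d : Gen → ℤ)
    (h : ∑ x, d x ≠ N) : symSum g N d = 0 := by
  refine Finset.sum_eq_zero fun f _ => if_neg fun hf => h ?_
  have : ∑ x : Gen, (Finset.univ.filter fun i => f i = x).card = N := by
    have := Finset.card_eq_sum_card_fiberwise (f := f) (s := Finset.univ) (t := Finset.univ)
      (fun _ _ => Finset.mem_coe.2 (Finset.mem_univ _))
    simpa using this.symm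
  rw [← Finset.sum_congr rfl fun x _ => hf x]
  exact_mod_cast this

theorem symSum_eq_zero_of_neg {A : Type*} [Ring A] (g : Gen → A) (N : ℕ) (d : Gen → ℤ) (x : Gen)
    (h : d x < 0) : symSum g N d = 0 := by
  refine Finset.sum_eq_zero fun f _ => if_neg fun hf => ?_
  have := hf x
  omega

theorem symSum_eq_S (ε : ℝ) (N : ℕ) (d : Gen → ℤ) (h : ∑ x, d x = N) :
    symSum (gen ε) N d = S ε d := by
  rw [S, h, Int.toNat_natCast]

theorem sum_sub_single (d : Gen → ℤ) (y : Gen) (c : ℤ) :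
    ∑ x, (d - Pi.single y c : Gen → ℤ) x = ∑ x, d x - c := by
  simp [Finset.sum_sub_distrib]

/-! The products of a generator with a symmetric polynomial. -/

theorem gen_symSum_comm (ε : ℝ) (x : Gen) (N : ℕ) (d : Gen → ℤ) :
    gen ε x * symSum (gen ε) (N + 1) d - symSum (gen ε) (N + 1) d * gen ε x =
      ((N + 1 : ℂ) * (ε * sgn x)) • symSum (gen ε) N (d - Pi.single (bar x) 1) := by
  induction N generalizing d with
  | zero =>
    rw [symSum_succ, Finset.mul_sum, Finset.sum_mul, ← Finset.sum_sub_distrib]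
    have : ∀ y, gen ε x * (symSum (gen ε) 0 (d - Pi.single y 1) * gen ε y) -
        symSum (gen ε) 0 (d - Pi.single y 1) * gen ε y * gen ε x =
        if y = bar x then (ε * sgn x) • symSum (gen ε) 0 (d - Pi.single y 1) else 0 := by
      intro y
      rw [symSum_zero]
      have := gen_comm ε x y
      split_ifs with h1 h2 h2
      · rw [if_pos h2] at this
        rw [one_mul, this, Algebra.algebraMap_eq_smul_one]
      · simpa [h2] using this
      all_goals simp
    simp [this]
  | succ N ih =>
    rw [symSum_succ, Finset.mul_sum, Finset.sum_mul, ← Finset.sum_sub_distrib]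
    have : ∀ y, gen ε x * (symSum (gen ε) (N + 1) (d - Pi.single y 1) * gen ε y) -
        symSum (gen ε) (N + 1) (d - Pi.single y 1) * gen ε y * gen ε x =
        ((N + 1 : ℂ) * (ε * sgn x)) •
          (symSum (gen ε) N (d - Pi.single (bar x) 1 - Pi.single y 1) * gen ε y) +
        if y = bar x then (ε * sgn x) • symSum (gen ε) (N + 1) (d - Pi.single y 1) else 0 := by
      intro y
      have h0 := ih (d - Pi.single y 1)
      rw [sub_right_comm] at h0
      rw [← smul_mul_assoc, ← h0]
      have h1 : (if y = bar x then (ε * sgn x) • symSum (gen ε) (N + 1) (d - Pi.single y 1)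
          else 0) = symSum (gen ε) (N + 1) (d - Pi.single y 1) *
            (gen ε x * gen ε y - gen ε y * gen ε x) := by
        rw [gen_comm]
        split_ifs <;> simp [Algebra.algebraMap_eq_smul_one]
      rw [h1]
      generalize symSum (gen ε) (N + 1) (d - Pi.single y 1) = T
      simp only [mul_sub, sub_mul, mul_assoc]
      abel
    simp only [this, Finset.sum_add_distrib, ← Finset.smul_sum, ← symSum_succ,
      Finset.sum_ite_eq', Finset.mem_univ, if_true]
    rw [← add_smul]
    congr 1
    push_cast
    ring

theorem gen_mul_symSum (ε : ℝ) (x : Gen) (N : ℕ) (d : Gen → ℤ) :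
    gen ε x * symSum (gen ε) N d =
      ((d x + 1 : ℂ) / (N + 1)) • symSum (gen ε) (N + 1) (d + Pi.single x 1) +
      ((N : ℂ) / 2 * (ε * sgn x)) • symSum (gen ε) (N - 1) (d - Pi.single (bar x) 1) := by
  suffices h : (d x + 1 : ℂ) • symSum (gen ε) (N + 1) (d + Pi.single x 1) =
      (N + 1 : ℂ) • (gen ε x * symSum (gen ε) N d) -
      ((N + 1 : ℂ) * N / 2 * (ε * sgn x)) •
        symSum (gen ε) (N - 1) (d - Pi.single (bar x) 1) by
    have hN : (N + 1 : ℂ) ≠ 0 := by exact_mod_cast N.succ_ne_zero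
    rw [div_eq_inv_mul, mul_smul, h, smul_sub, smul_smul, smul_smul, inv_mul_cancel₀ hN, one_smul]
    rw [show (N + 1 : ℂ)⁻¹ * ((N + 1 : ℂ) * N / 2 * (ε * sgn x)) = (N : ℂ) / 2 * (ε * sgn x) by
      field_simp]
    abel
  have hrec : ∀ (N : ℕ) (d : Gen → ℤ),
      (d x + 1 : ℂ) • symSum (gen ε) (N + 1) (d + Pi.single x 1) =
      symSum (gen ε) N d * gen ε x + ∑ y, (((d - Pi.single y 1 : Gen → ℤ) x : ℤ) + 1 : ℂ) •
        symSum (gen ε) N ((d - Pi.single y 1) + Pi.single x 1) * gen ε y := by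
    intro N d
    rw [symSum_succ, Finset.smul_sum, ← sub_eq_iff_eq_add, ← Finset.sum_sub_distrib]
    have : ∀ y, (d x + 1 : ℂ) • (symSum (gen ε) N (d + Pi.single x 1 - Pi.single y 1) * gen ε y) -
        ((((d - Pi.single y 1 : Gen → ℤ) x : ℤ) + 1 : ℂ) •
        symSum (gen ε) N ((d - Pi.single y 1) + Pi.single x 1) * gen ε y) =
        if y = x then symSum (gen ε) N d * gen ε x else 0 := by
      intro y
      rw [show d + Pi.single x 1 - Pi.single y 1 = (d - Pi.single y 1) + Pi.single x 1 by abel,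
        smul_mul_assoc, ← sub_smul]
      split_ifs with h
      · subst h; simp
      · simp [Ne.symm h]
    rw [Finset.sum_congr rfl fun y _ => this y]
    simp
  induction N generalizing d with
  | zero =>
    rw [hrec, Finset.sum_eq_zero]
    · rw [symSum_zero]
      split_ifs <;> simp
    · intro y _
      rw [symSum_zero]
      split_ifs with h
      · have := congrFun h x
        simp only [Pi.add_apply, Pi.single_eq_same, Pi.zero_apply] at this
        have h2 : (((d - Pi.single y 1 : Gen → ℤ) x : ℤ) + 1 : ℂ) = 0 := by exact_mod_cast this
        rw [h2]; simp
      · simp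
  | succ N ih =>
    rw [hrec]
    have h1 := gen_symSum_comm ε x N d
    rw [sub_eq_iff_eq_add', ← sub_eq_iff_eq_add] at h1
    have h2 : ∑ y, (((d - Pi.single y 1 : Gen → ℤ) x : ℤ) + 1 : ℂ) •
        symSum (gen ε) (N + 1) ((d - Pi.single y 1) + Pi.single x 1) * gen ε y =
        (N + 1 : ℂ) • (gen ε x * symSum (gen ε) (N + 1) d) -
        ((N + 1 : ℂ) * N / 2 * (ε * sgn x)) •
          symSum (gen ε) N (d - Pi.single (bar x) 1) := by
      simp only [ih, sub_mul, Finset.sum_sub_distrib, smul_mul_assoc, ← Finset.smul_sum,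
        mul_assoc (gen ε x), ← Finset.mul_sum, ← symSum_succ]
      congr 1
      rcases N with _ | N
      · simp
      · rw [symSum_succ _ N (d - Pi.single (bar x) 1)]
        simp only [Nat.add_sub_cancel, sub_right_comm d (Pi.single (bar x) 1)]
    rw [h2, ← h1]
    simp only [Nat.add_sub_cancel]
    push_cast
    module

/-! ### The symmetric polynomials form a basis -/

section Symbol

open MvPolynomial

/-- Commutative polynomials in the four letters (symbols of elements of `W(ε)`). -/
abbrev V : Type := MvPolynomial Gen ℂ

theorem pderiv_comm' (i j : Gen) (p : V) : pderiv i (pderiv j p) = pderiv j (pderiv i p) := by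
  have h : ⁅pderiv (R := ℂ) i, pderiv (R := ℂ) j⁆ = 0 := by
    refine MvPolynomial.derivation_ext fun k => ?_
    rw [Derivation.commutator_apply, pderiv_X, pderiv_X]
    simp only [Pi.single_apply, apply_ite (pderiv (R := ℂ) _), pderiv_one, map_zero]
    simp
  have := congrArg (fun D => D p) h
  simpa [Derivation.commutator_apply, sub_eq_zero] using this

/-- Left multiplication by a generator, on symbols. -/
noncomputable def Lop (ε : ℝ) (x : Gen) : Module.End ℂ V :=
  LinearMap.mulLeft ℂ (X x) + ((ε : ℂ) / 2 * sgn x) • (pderiv (R := ℂ) (bar x)).toLinearMap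

/-- Right multiplication by a generator, on symbols. -/
noncomputable def Rop (ε : ℝ) (x : Gen) : Module.End ℂ V :=
  LinearMap.mulLeft ℂ (X x) - ((ε : ℂ) / 2 * sgn x) • (pderiv (R := ℂ) (bar x)).toLinearMap

theorem Lop_apply (ε : ℝ) (x : Gen) (p : V) :
    Lop ε x p = X x * p + C ((ε : ℂ) / 2 * sgn x) * pderiv (bar x) p := by
  change X x * p + ((ε : ℂ) / 2 * sgn x) • pderiv (bar x) p = _
  rw [smul_eq_C_mul]

theorem Rop_apply (ε : ℝ) (x : Gen) (p : V) :
    Rop ε x p = X x * p - C ((ε : ℂ) / 2 * sgn x) * pderiv (bar x) p := by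
  change X x * p - ((ε : ℂ) / 2 * sgn x) • pderiv (bar x) p = _
  rw [smul_eq_C_mul]

theorem Lop_comm (ε : ℝ) (x y : Gen) :
    Lop ε x * Lop ε y - Lop ε y * Lop ε x =
      if y = bar x then algebraMap ℂ _ (ε * sgn x) else 0 := by
  refine LinearMap.ext fun p => ?_
  have h2 : (C (ε : ℂ) : V) = C ((ε : ℂ) / 2) + C ((ε : ℂ) / 2) := by rw [← C_add]; ring_nf
  have key : (Lop ε x * Lop ε y - Lop ε y * Lop ε x) p =
      C ((ε : ℂ) / 2 * sgn x) * (pderiv (bar x) (X y)) * p -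
      C ((ε : ℂ) / 2 * sgn y) * (pderiv (bar y) (X x)) * p := by
    simp only [LinearMap.sub_apply, Module.End.mul_apply, Lop_apply, map_add, pderiv_mul, pderiv_C,
      zero_mul, zero_add]
    rw [pderiv_comm' (bar y) (bar x)]
    ring
  have hr : (if y = bar x then algebraMap ℂ (Module.End ℂ V) (ε * sgn x) else 0) p =
      if y = bar x then (C ((ε : ℂ) / 2) + C ((ε : ℂ) / 2)) * C (sgn x) * p else 0 := by
    split_ifs
    · rw [Module.algebraMap_end_apply, smul_eq_C_mul, C_mul, h2]
    · rfl
  rw [key, hr, C_mul, C_mul]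
  cases x <;> cases y <;> simp [bar, sgn, pderiv_X] <;> ring

theorem Lop_Rop_comm (ε : ℝ) (x y : Gen) : Commute (Lop ε x) (Rop ε y) := by
  refine LinearMap.ext fun p => ?_
  rw [← sub_eq_zero]
  have key : (Lop ε x * Rop ε y) p - (Rop ε y * Lop ε x) p =
      C ((ε : ℂ) / 2 * sgn x) * (pderiv (bar x) (X y)) * p +
      C ((ε : ℂ) / 2 * sgn y) * (pderiv (bar y) (X x)) * p := by
    simp only [Module.End.mul_apply, Lop_apply, Rop_apply, map_add, map_sub, pderiv_mul, pderiv_C,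
      zero_mul, zero_add]
    rw [pderiv_comm' (bar y) (bar x)]
    ring
  rw [key]
  cases x <;> cases y <;> simp [bar, sgn, pderiv_X]

/-- The action of `W(ε)` on symbols by left multiplication. -/
noncomputable def rep (ε : ℝ) : W ε →ₐ[ℂ] Module.End ℂ V :=
  liftW ε (Lop ε) (by
    intro x y h
    cases h with
    | aa => simpa [bar, sgn] using Lop_comm ε aM aP
    | bb => simpa [bar, sgn] using Lop_comm ε bM bP
    | ab x y hx hy =>
      have := Lop_comm ε x y
      rcases hx with rfl | rfl <;> rcases hy with rfl | rfl <;> simpa [bar, sgn] using this)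

theorem rep_gen (ε : ℝ) (x : Gen) : rep ε (gen ε x) = Lop ε x := liftW_gen ..

/-- The (Weyl) symbol of an element of `W(ε)`. -/
noncomputable def symb (ε : ℝ) : W ε →ₗ[ℂ] V :=
  (LinearMap.applyₗ (1 : V)).comp (rep ε).toLinearMap

theorem symb_apply (ε : ℝ) (w : W ε) : symb ε w = rep ε w 1 := rfl

theorem rep_Rop_comm (ε : ℝ) (w : W ε) (x : Gen) : Commute (rep ε w) (Rop ε x) := by
  induction w using W_induction with
  | scal c => rw [AlgHom.commutes]; exact Algebra.commutes c _
  | g y => rw [rep_gen]; exact Lop_Rop_comm ε y x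
  | mul u v hu hv => rw [map_mul]; exact hu.mul_left hv
  | add u v hu hv => rw [map_add]; exact hu.add_left hv

theorem symb_mul_gen (ε : ℝ) (w : W ε) (x : Gen) :
    symb ε (w * gen ε x) = Rop ε x (symb ε w) := by
  have h : rep ε w (Rop ε x 1) = Rop ε x (rep ε w 1) :=
    congrArg (fun f : Module.End ℂ V => f 1) (rep_Rop_comm ε w x)
  rw [symb_apply, symb_apply, map_mul, Module.End.mul_apply, rep_gen, ← h, Lop_apply, Rop_apply]
  simp

theorem pderiv_symSum (y : Gen) (N : ℕ) (d : Gen → ℤ) :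
    pderiv y (symSum (X : Gen → V) N d) =
      (N : V) * symSum (X : Gen → V) (N - 1) (d - Pi.single y 1) := by
  induction N generalizing d with
  | zero => rw [symSum_zero]; split_ifs <;> simp
  | succ N ih =>
    rw [symSum_succ, map_sum]
    simp only [pderiv_mul, ih, pderiv_X, Finset.sum_add_distrib]
    have h1 : ∑ z, symSum (X : Gen → V) N (d - Pi.single z 1) *
        (Pi.single y 1 : Gen → V) z = symSum (X : Gen → V) N (d - Pi.single y 1) := by
      simp [Pi.single_apply]
    have h2 : ∑ z, (N : V) * symSum (X : Gen → V) (N - 1) (d - Pi.single z 1 - Pi.single y 1) *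
        X z = (N : V) * symSum (X : Gen → V) N (d - Pi.single y 1) := by
      rcases N with _ | N
      · simp
      · rw [symSum_succ _ N, Finset.mul_sum]
        simp only [Nat.add_sub_cancel, sub_right_comm d (Pi.single y 1), mul_assoc]
    rw [h2, h1]
    simp only [Nat.add_sub_cancel]
    push_cast
    rw [add_mul, one_mul]

theorem symb_symSum (ε : ℝ) (N : ℕ) (d : Gen → ℤ) :
    symb ε (symSum (gen ε) N d) = symSum (X : Gen → V) N d := by
  induction N generalizing d with
  | zero => rw [symSum_zero, symSum_zero]; split_ifs <;> simp [symb_apply]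
  | succ N ih =>
    rw [symSum_succ, map_sum, symSum_succ]
    simp only [symb_mul_gen, Rop_apply, ih, Finset.sum_sub_distrib, pderiv_symSum]
    rw [sub_eq_iff_eq_add]
    simp only [Gen.sum_eq, bar, sgn, sub_right_comm d (Pi.single aP 1),
      sub_right_comm d (Pi.single bP 1)]
    simp
    ring

theorem exists_word (d : Gen → ℕ) : ∃ f : Fin (∑ x, d x) → Gen,
    ∀ x, (Finset.univ.filter fun i => f i = x).card = d x := by
  have e : (Σ x, Fin (d x)) ≃ Fin (∑ x, d x) := Fintype.equivFinOfCardEq (by simp)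
  refine ⟨fun i => (e.symm i).1, fun x => ?_⟩
  rw [← Fintype.card_subtype, Fintype.card_congr ((e.symm.subtypeEquiv (fun i => Iff.rfl)).trans
    (Equiv.sigmaSubtype x)), Fintype.card_fin]

theorem symSum_X (d : Gen → ℕ) : ∃ c : ℂ, c ≠ 0 ∧
    symSum (X : Gen → V) (∑ x, d x) (fun x => (d x : ℤ)) =
      c • monomial (Finsupp.equivFunOnFinite.symm d) 1 := by
  refine ⟨((Finset.univ.filter fun f : Fin (∑ x, d x) → Gen =>
    ∀ x, (Finset.univ.filter fun i => f i = x).card = d x).card : ℂ), ?_, ?_⟩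
  · obtain ⟨f, hf⟩ := exists_word d
    exact_mod_cast (Finset.card_pos.2 ⟨f, by simpa using hf⟩).ne'
  · unfold symSum
    simp only [Nat.cast_inj]
    rw [← Finset.sum_filter, Nat.cast_smul_eq_nsmul]
    refine Finset.sum_eq_card_nsmul fun f hf => ?_
    rw [Finset.mem_filter] at hf
    rw [List.prod_ofFn, monomial_eq, C_1, one_mul, Finsupp.prod_fintype _ _ (by simp),
      Finset.prod_comp]
    rw [Finset.prod_subset (Finset.subset_univ _)]
    · exact Finset.prod_congr rfl fun x _ => by rw [hf.2 x]; simp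
    · intro x _ hx
      rw [Finset.card_eq_zero.2, pow_zero]
      rw [Finset.filter_eq_empty_iff]
      rintro i - rfl
      exact hx (Finset.mem_image_of_mem _ (Finset.mem_univ i))

/-- The polynomials `symSum X`, which are positive multiples of monomials. -/
theorem exists_symBasis : ∃ b : Module.Basis (Gen → ℕ) ℂ V,
    ∀ d, b d = symSum (X : Gen → V) (∑ x, d x) (fun x => (d x : ℤ)) := by
  choose c hc h using symSum_X
  refine ⟨((basisMonomials Gen ℂ).reindex Finsupp.equivFunOnFinite).isUnitSMul
    (fun d => (hc d).isUnit), fun d => ?_⟩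
  rw [Module.Basis.isUnitSMul_apply, h]
  simp

theorem S_natCast (ε : ℝ) (d : Gen → ℕ) :
    S ε (fun x => (d x : ℤ)) = symSum (gen ε) (∑ x, d x) (fun x => (d x : ℤ)) :=
  (symSum_eq_S _ _ _ (by push_cast; rfl)).symm

theorem S_mem_span (ε : ℝ) (d : Gen → ℤ) :
    S ε d ∈ Submodule.span ℂ (Set.range fun d : Gen → ℕ => S ε (fun x => (d x : ℤ))) := by
  by_cases h : ∀ x, 0 ≤ d x
  · exact Submodule.subset_span ⟨fun x => (d x).toNat,
      congrArg (S ε) (funext fun x => Int.toNat_of_nonneg (h x))⟩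
  · push Not at h
    obtain ⟨x, hx⟩ := h
    rw [S, symSum_eq_zero_of_neg _ _ _ x hx]
    exact Submodule.zero_mem _

theorem symSum_mem_span (ε : ℝ) (N : ℕ) (d : Gen → ℤ) :
    symSum (gen ε) N d ∈
      Submodule.span ℂ (Set.range fun d : Gen → ℕ => S ε (fun x => (d x : ℤ))) := by
  by_cases h : ∑ x, d x = N
  · rw [symSum_eq_S _ _ _ h]; exact S_mem_span ε d
  · rw [symSum_eq_zero _ _ _ h]; exact Submodule.zero_mem _

theorem S_span (ε : ℝ) :
    ⊤ ≤ Submodule.span ℂ (Set.range fun d : Gen → ℕ => S ε (fun x => (d x : ℤ))) := by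
  set U := Submodule.span ℂ (Set.range fun d : Gen → ℕ => S ε (fun x => (d x : ℤ))) with hU
  have hmul : ∀ w u : W ε, u ∈ U → w * u ∈ U := by
    intro w
    induction w using W_induction with
    | scal c => intro u hu; rw [← Algebra.smul_def]; exact U.smul_mem c hu
    | g x =>
      intro u hu
      induction hu using Submodule.span_induction with
      | mem u hu =>
        obtain ⟨d, rfl⟩ := hu
        dsimp only
        rw [S, gen_mul_symSum]
        exact U.add_mem (U.smul_mem _ (symSum_mem_span ε _ _)) (U.smul_mem _ (symSum_mem_span ε _ _))
      | zero => rw [mul_zero]; exact U.zero_mem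
      | add u v _ _ hu hv => rw [mul_add]; exact U.add_mem hu hv
      | smul c u _ hu => rw [mul_smul_comm]; exact U.smul_mem c hu
    | mul u v hu hv => intro t ht; rw [mul_assoc]; exact hu _ (hv _ ht)
    | add u v hu hv => intro t ht; rw [add_mul]; exact U.add_mem (hu _ ht) (hv _ ht)
  intro w _
  have h1 : (1 : W ε) ∈ U := by
    have := symSum_mem_span ε 0 0
    rwa [symSum_zero, if_pos rfl] at this
  simpa using hmul w 1 h1

theorem S_linearIndependent (ε : ℝ) :
    LinearIndependent ℂ (fun d : Gen → ℕ => S ε (fun x => (d x : ℤ))) := by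
  obtain ⟨b, hb⟩ := exists_symBasis
  refine LinearIndependent.of_comp (symb ε) ?_
  convert b.linearIndependent using 1
  funext d
  rw [Function.comp_apply, S_natCast, symb_symSum, hb]

/-- The basis of `W(ε)` given by the totally symmetric polynomials `S(s,t,u,v)`. -/
noncomputable def basisS (ε : ℝ) : Module.Basis (Gen → ℕ) ℂ (W ε) :=
  Module.Basis.mk (S_linearIndependent ε) (S_span ε)

theorem basisS_apply (ε : ℝ) (d : Gen → ℕ) : basisS ε d = S ε (fun x => (d x : ℤ)) :=
  Module.Basis.mk_apply ..

theorem symb_basisS (ε : ℝ) (d : Gen → ℕ) :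
    symb ε (basisS ε d) = symSum (X : Gen → V) (∑ x, d x) (fun x => (d x : ℤ)) := by
  rw [basisS_apply, S_natCast, symb_symSum]

theorem symb_bijective (ε : ℝ) : Function.Bijective (symb ε) := by
  obtain ⟨b, hb⟩ := exists_symBasis
  have : symb ε = ((basisS ε).equiv b (Equiv.refl _)).toLinearMap :=
    (basisS ε).ext fun d => by rw [symb_basisS]; simp [hb]
  rw [this]
  exact LinearEquiv.bijective _

end Symbol

/-! ### The formal trace, the space `Ψ` and the projection `ρ` -/

/-- The formal trace, given on the basis of symmetric polynomials by
`tr S(s,t,u,v) = 2 S(s-1,t-1,u,v) + 2 S(s,t,u-1,v-1)`: it removes a final pair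
`a₊a₋`, `a₋a₊`, `b₊b₋` or `b₋b₊` from each word. -/
noncomputable def tr (ε : ℝ) : W ε →ₗ[ℂ] W ε :=
  (basisS ε).constr ℂ fun d =>
    (2 : ℂ) • S ε ((fun x => (d x : ℤ)) - Pi.single aM 1 - Pi.single aP 1) +
    (2 : ℂ) • S ε ((fun x => (d x : ℤ)) - Pi.single bM 1 - Pi.single bP 1)

/-- `Ψ`, the space of formally traceless symmetric polynomials. -/
noncomputable def Psi (ε : ℝ) : Submodule ℂ (W ε) := LinearMap.ker (tr ε)

/-- `J₀ = ½ (a₊a₋ - b₊b₋)`. -/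
noncomputable def J0 (ε : ℝ) : W ε :=
  (1 / 2 : ℂ) • (gen ε aP * gen ε aM - gen ε bP * gen ε bM)

/-- `J₊ = a₊b₋`. -/
noncomputable def Jp (ε : ℝ) : W ε := gen ε aP * gen ε bM

/-- `J₋ = a₋b₊`. -/
noncomputable def Jm (ε : ℝ) : W ε := gen ε aM * gen ε bP

/-- `K₀ = ½ (a₊a₋ + b₊b₋ + ε)`. -/
noncomputable def K0 (ε : ℝ) : W ε :=
  (1 / 2 : ℂ) • (gen ε aP * gen ε aM + gen ε bP * gen ε bM + algebraMap ℂ (W ε) ε)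

/-- `R̂ = √(R² + ε²/4)`. -/
noncomputable def Rhat (ε R : ℝ) : ℝ := √(R ^ 2 + ε ^ 2 / 4)

/-- The left ideal `{w (K₀ - R̂) | w ∈ W(ε)}`, as a subspace. -/
noncomputable def kerRho (ε R : ℝ) : Submodule ℂ (W ε) :=
  LinearMap.range (LinearMap.mulRight ℂ (K0 ε - algebraMap ℂ (W ε) (Rhat ε R)))

section Complement

open MvPolynomial

/-- The Euler operator. -/
noncomputable def Eul (p : V) : V := ∑ x, X x * pderiv x p

/-- The Laplacian. -/
noncomputable def Del (p : V) : V :=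
  pderiv aM (pderiv aP p) + pderiv bM (pderiv bP p)

/-- The symbol of `w ↦ w (2 K₀ - 2 c)`. -/
noncomputable def Mop (ε c : ℝ) (p : V) : V :=
  Rop ε aM (Rop ε aP p) + Rop ε bM (Rop ε bP p) + C (ε : ℂ) * p - C (2 * c : ℂ) * p

theorem Del_Eul (p : V) : Del (Eul p) = Eul (Del p) + 2 * Del p := by
  simp only [Del, Eul, Gen.sum_eq, map_add, pderiv_mul, pderiv_X_self, pderiv_one,
    pderiv_X_of_ne (show aM ≠ aP by decide), pderiv_X_of_ne (show aM ≠ bM by decide),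
    pderiv_X_of_ne (show aM ≠ bP by decide), pderiv_X_of_ne (show aP ≠ aM by decide),
    pderiv_X_of_ne (show aP ≠ bM by decide), pderiv_X_of_ne (show aP ≠ bP by decide),
    pderiv_X_of_ne (show bM ≠ aM by decide), pderiv_X_of_ne (show bM ≠ aP by decide),
    pderiv_X_of_ne (show bM ≠ bP by decide), pderiv_X_of_ne (show bP ≠ aM by decide),
    pderiv_X_of_ne (show bP ≠ aP by decide), pderiv_X_of_ne (show bP ≠ bM by decide),
    zero_mul, zero_add,
    pderiv_comm' aP aM, pderiv_comm' bM aM, pderiv_comm' bP aM, pderiv_comm' bM aP,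
    pderiv_comm' bP aP, pderiv_comm' bP bM]
  ring

theorem Del_Mop (ε c : ℝ) (p : V) : Del (Mop ε c p) = Mop ε c (Del p) + Eul p + 2 * p := by
  simp only [Del, Eul, Mop, Rop_apply, bar, sgn, mul_one, mul_neg, map_neg, Gen.sum_eq, map_add,
    map_sub, pderiv_mul, pderiv_X_self, pderiv_one, pderiv_C,
    pderiv_X_of_ne (show aM ≠ aP by decide), pderiv_X_of_ne (show aM ≠ bM by decide),
    pderiv_X_of_ne (show aM ≠ bP by decide), pderiv_X_of_ne (show aP ≠ aM by decide),
    pderiv_X_of_ne (show aP ≠ bM by decide), pderiv_X_of_ne (show aP ≠ bP by decide),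
    pderiv_X_of_ne (show bM ≠ aM by decide), pderiv_X_of_ne (show bM ≠ aP by decide),
    pderiv_X_of_ne (show bM ≠ bP by decide), pderiv_X_of_ne (show bP ≠ aM by decide),
    pderiv_X_of_ne (show bP ≠ aP by decide), pderiv_X_of_ne (show bP ≠ bM by decide),
    map_zero, zero_mul, zero_add,
    pderiv_comm' aP aM, pderiv_comm' bM aM, pderiv_comm' bP aM, pderiv_comm' bM aP,
    pderiv_comm' bP aP, pderiv_comm' bP bM]
  ring

theorem Del_add (p q : V) : Del (p + q) = Del p + Del q := by
  simp only [Del, map_add]; ring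

theorem Del_sub (p q : V) : Del (p - q) = Del p - Del q := by
  simp only [Del, map_sub]; ring

theorem Del_C_mul (c : ℂ) (p : V) : Del (C c * p) = C c * Del p := by
  simp only [Del, pderiv_C_mul]; ring

theorem Mop_sub (ε c : ℝ) (p q : V) : Mop ε c (p - q) = Mop ε c p - Mop ε c q := by
  simp only [Mop, map_sub]; ring

theorem Mop_zero (ε c : ℝ) : Mop ε c 0 = 0 := by simp [Mop]

/-- `p ↦ j E p + c p`. -/
noncomputable def Aop (j c : ℕ) : V →ₗ[ℂ] V where
  toFun p := j * Eul p + c * p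
  map_add' p q := by simp only [Eul, map_add, mul_add, Finset.sum_add_distrib]; ring
  map_smul' a p := by
    simp only [Eul, smul_eq_C_mul, pderiv_C_mul, RingHom.id_apply, mul_left_comm _ (C a),
      ← Finset.mul_sum, ← mul_add]

theorem Aop_apply (j c : ℕ) (p : V) : Aop j c p = j * Eul p + c * p := rfl

theorem Aop_bijective (j c : ℕ) (hc : 0 < c) : Function.Bijective (Aop j c) := by
  have hw : ∀ m : Gen →₀ ℕ, IsUnit ((j * m.degree + c : ℕ) : ℂ) := fun m =>
    (Nat.cast_ne_zero.2 (by omega)).isUnit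
  have : Aop j c = ((basisMonomials Gen ℂ).equiv
      ((basisMonomials Gen ℂ).isUnitSMul hw) (Equiv.refl _)).toLinearMap := by
    refine (basisMonomials Gen ℂ).ext fun m => ?_
    have h1 : Eul (monomial m (1 : ℂ)) = m.degree • monomial m (1 : ℂ) :=
      (isHomogeneous_monomial (1 : ℂ) rfl).sum_X_mul_pderiv
    rw [LinearEquiv.coe_coe, Module.Basis.equiv_apply, Equiv.refl_apply,
      Module.Basis.isUnitSMul_apply, coe_basisMonomials, Aop_apply, h1, nsmul_eq_mul,
      Nat.cast_smul_eq_nsmul, nsmul_eq_mul]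
    push_cast
    ring
  rw [this]
  exact LinearEquiv.bijective _

theorem Del_Aop (j c : ℕ) (p : V) : Del (Aop j c p) = Aop j (c + 2 * j) (Del p) := by
  rw [Aop_apply, Aop_apply, Del_add, ← C_eq_coe_nat, ← C_eq_coe_nat, Del_C_mul, Del_C_mul,
    Del_Eul, C_eq_coe_nat, C_eq_coe_nat]
  push_cast
  ring

theorem Aop_add_eq (ε e : ℝ) (j c : ℕ) (g : V) :
    Aop (j + 1) (c + 2 * j + 2) g + Mop ε e (Del g) =
      Aop j (c + 2 * j) g + Del (Mop ε e g) := by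
  rw [Del_Mop]; simp only [Aop_apply]; push_cast; ring

theorem exists_nilp (p : V) : ∃ k : ℕ, Del^[k] p = 0 := by
  have Del_zero : Del 0 = 0 := by simp [Del]
  have iter_zero : ∀ k, Del^[k] 0 = 0 := fun k => Function.iterate_fixed Del_zero k
  have iter_add : ∀ k (p q : V), Del^[k] (p + q) = Del^[k] p + Del^[k] q := by
    intro k
    induction k with
    | zero => intro p q; rfl
    | succ k ih => intro p q; simp only [Function.iterate_succ_apply, Del_add, ih]
  have h0 : ∀ (i : Gen) (p : V), p.IsHomogeneous 0 → pderiv i p = 0 := by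
    intro i p hp
    rw [← totalDegree_zero_iff_isHomogeneous, totalDegree_eq_zero_iff_eq_C] at hp
    rw [hp, pderiv_C]
  have hom : ∀ N (p : V), p.IsHomogeneous N → ∃ k : ℕ, Del^[k] p = 0 := by
    intro N
    induction N using Nat.strong_induction_on with
    | _ N ih =>
      intro p hp
      rcases N with _ | _ | N
      · exact ⟨1, by simp [Del, h0 _ p hp]⟩
      · exact ⟨1, by simp [Del, h0 _ _ (hp.pderiv (i := aP)), h0 _ _ (hp.pderiv (i := bP))]⟩
      · have : (Del p).IsHomogeneous N := (hp.pderiv.pderiv).add (hp.pderiv.pderiv)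
        obtain ⟨k, hk⟩ := ih N (by omega) _ this
        exact ⟨k + 1, by rw [Function.iterate_succ_apply, hk]⟩
  induction p using MvPolynomial.monomial_add_induction_on with
  | C a => exact hom 0 _ (isHomogeneous_C _ _)
  | monomial_add m a p _ _ ih =>
    obtain ⟨k, hk⟩ := ih
    obtain ⟨l, hl⟩ := hom _ (monomial m a) (isHomogeneous_monomial a rfl)
    refine ⟨k + l, ?_⟩
    rw [iter_add, Function.iterate_add_apply Del k l, hl, iter_zero, add_comm k,
      Function.iterate_add_apply, hk, iter_zero, add_zero]

theorem eq_zero_of_Aop (ε e : ℝ) (k j c : ℕ) (hc : 0 < c) (g : V) (hk : Del^[k] g = 0)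
    (h : Aop j c g + Mop ε e (Del g) = 0) : g = 0 := by
  induction k generalizing j c g with
  | zero => exact hk
  | succ k ih =>
    have hD : Del g = 0 := by
      refine ih (j + 1) (c + 2 * j + 2) (by omega) (Del g) hk ?_
      rw [Aop_add_eq, ← Del_Aop, ← Del_add, h]
      simp [Del]
    rw [hD, Mop_zero, add_zero] at h
    exact (Aop_bijective j c hc).1 (by rw [h, map_zero])

theorem exists_Aop (ε e : ℝ) (k j c : ℕ) (hc : 0 < c) (p : V) (hk : Del^[k] p = 0) :
    ∃ g, Aop j c g + Mop ε e (Del g) = p := by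
  induction k generalizing j c p with
  | zero =>
    refine ⟨0, ?_⟩
    rw [show p = 0 from hk]
    simp [Del, Mop_zero]
  | succ k ih =>
    obtain ⟨u, hu⟩ := ih (j + 1) (c + 2 * j + 2) (by omega) (Del p) hk
    obtain ⟨g, hg⟩ := (Aop_bijective j c hc).2 (p - Mop ε e u)
    have hD : Del g = u := by
      refine (Aop_bijective j (c + 2 * j) (by omega)).1 ?_
      rw [← Del_Aop, hg, Del_sub, ← hu, Aop_add_eq, add_sub_cancel_right]
    exact ⟨g, by rw [hD, hg, sub_add_cancel]⟩

theorem Aop_symSum (j c N : ℕ) (d : Gen → ℤ) :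
    Aop j c (symSum (X : Gen → V) N d) =
      ((j * N + c : ℕ) : V) * symSum (X : Gen → V) N d := by
  have : Eul (symSum (X : Gen → V) N d) = (N : V) * symSum (X : Gen → V) N d := by
    rcases N with _ | N
    · simp [Eul, pderiv_symSum]
    · simp only [Eul, pderiv_symSum, Nat.add_sub_cancel]
      rw [symSum_succ _ N, Finset.mul_sum]
      exact Finset.sum_congr rfl fun x _ => by ring
  rw [Aop_apply, this]
  push_cast
  ring

theorem two_Del_symb (ε : ℝ) (w : W ε) :
    2 * Del (symb ε w) = Aop 1 2 (Aop 1 1 (symb ε (tr ε w))) := by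
  let D : V →ₗ[ℂ] V :=
    ⟨⟨Del, Del_add⟩, fun a p => by simp [smul_eq_C_mul, Del_C_mul]⟩
  have key : ((2 : ℂ) • D) ∘ₗ symb ε = Aop 1 2 ∘ₗ Aop 1 1 ∘ₗ symb ε ∘ₗ tr ε := by
    refine (basisS ε).ext fun d => ?_
    have hS : ∀ x y : Gen, symb ε (S ε ((fun x => (d x : ℤ)) - Pi.single x 1 - Pi.single y 1)) =
        symSum (X : Gen → V) ((∑ x, d x) - 2)
          ((fun x => (d x : ℤ)) - Pi.single x 1 - Pi.single y 1) := by
      intro x y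
      rw [S, symb_symSum]
      congr 1
      rw [sum_sub_single, sum_sub_single]
      have : ∑ x, (d x : ℤ) = ((∑ x, d x : ℕ) : ℤ) := by push_cast; rfl
      rw [this]
      omega
    simp only [LinearMap.comp_apply, LinearMap.smul_apply, tr, Module.Basis.constr_basis,
      map_add, map_smul, hS, symb_basisS, Aop_symSum]
    change (2 : ℂ) • Del _ = _
    simp only [Del, pderiv_symSum, ← C_eq_coe_nat, pderiv_C_mul]
    rw [sub_right_comm _ (Pi.single aP 1), sub_right_comm _ (Pi.single bP 1)]
    simp only [C_eq_coe_nat, ← nsmul_eq_mul, map_nsmul, Aop_symSum]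
    have hz : ∑ x, d x < 2 → ∀ x y : Gen, symSum (X : Gen → V) ((∑ x, d x) - 2)
          ((fun x => (d x : ℤ)) - Pi.single x 1 - Pi.single y 1) = 0 := by
      intro h x y
      refine symSum_eq_zero _ _ _ ?_
      rw [sum_sub_single, sum_sub_single]
      have : ∑ x, (d x : ℤ) = ((∑ x, d x : ℕ) : ℤ) := by push_cast; rfl
      rw [this]
      omega
    by_cases h2 : ∑ x, d x < 2
    · simp [Nat.sub_sub, hz h2]
    · obtain ⟨N, hN⟩ : ∃ N, ∑ x, d x = N + 2 := ⟨∑ x, d x - 2, by omega⟩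
      simp only [hN, nsmul_eq_mul, smul_eq_C_mul, map_ofNat, Nat.sub_sub]
      simp
      ring
  have := congrArg (fun f : W ε →ₗ[ℂ] V => f w) key
  refine Eq.trans ?_ this
  change 2 * Del (symb ε w) = (2 : ℂ) • Del (symb ε w)
  rw [smul_eq_C_mul, map_ofNat]

theorem mem_Psi_iff (ε : ℝ) (w : W ε) : w ∈ Psi ε ↔ Del (symb ε w) = 0 := by
  rw [Psi, LinearMap.mem_ker]
  have h := two_Del_symb ε w
  constructor
  · intro h0
    rw [h0, map_zero, map_zero, map_zero] at h
    simpa using h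
  · intro h0
    rw [h0, mul_zero] at h
    have h1 := (Aop_bijective 1 2 (by norm_num)).1 (h.symm.trans (map_zero _).symm)
    have h2 := (Aop_bijective 1 1 (by norm_num)).1 (h1.trans (map_zero _).symm)
    exact (symb_bijective ε).1 (h2.trans (map_zero _).symm)

theorem two_symb_mul (ε c : ℝ) (u : W ε) :
    symb ε ((2 : ℂ) • (u * (K0 ε - algebraMap ℂ (W ε) c))) = Mop ε c (symb ε u) := by
  have : (2 : ℂ) • (u * (K0 ε - algebraMap ℂ (W ε) c)) =
      u * gen ε aP * gen ε aM + u * gen ε bP * gen ε bM + (ε : ℂ) • u - (2 * c : ℂ) • u := by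
    rw [K0, mul_sub, smul_sub, mul_smul_comm, smul_smul, mul_add, mul_add,
      Algebra.algebraMap_eq_smul_one, Algebra.algebraMap_eq_smul_one, mul_smul_comm,
      mul_smul_comm, mul_one, smul_smul, ← mul_assoc, ← mul_assoc]
    norm_num
  rw [this, map_sub, map_add, map_add, map_smul, map_smul, symb_mul_gen, symb_mul_gen,
    symb_mul_gen, symb_mul_gen, smul_eq_C_mul, smul_eq_C_mul]
  rfl

theorem isCompl_Psi_kerRho (ε R : ℝ) : IsCompl (Psi ε) (kerRho ε R) := by
  refine IsCompl.of_eq ?_ ?_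
  · rw [eq_bot_iff]
    rintro w ⟨h1, ⟨u, rfl⟩⟩
    have h2 := (mem_Psi_iff ε _).1 ((Psi ε).smul_mem 2 h1)
    rw [LinearMap.mulRight_apply, two_symb_mul, Del_Mop] at h2
    obtain ⟨k, hk⟩ := exists_nilp (symb ε u)
    have h3 := eq_zero_of_Aop ε (Rhat ε R) k 1 2 (by norm_num) _ hk (by
      rw [← h2, Aop_apply]; push_cast; ring)
    have h4 : u = 0 := (symb_bijective ε).1 (h3.trans (map_zero _).symm)
    rw [h4, map_zero]
    exact Submodule.zero_mem _
  · rw [eq_top_iff]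
    rintro w -
    obtain ⟨k, hk⟩ := exists_nilp (Del (symb ε w))
    obtain ⟨g, hg⟩ := exists_Aop ε (Rhat ε R) k 1 2 (by norm_num) _ hk
    obtain ⟨u, rfl⟩ := (symb_bijective ε).2 g
    refine Submodule.mem_sup.2 ⟨w - (2 : ℂ) • (u * (K0 ε - algebraMap ℂ (W ε) (Rhat ε R))), ?_,
      (2 : ℂ) • (u * (K0 ε - algebraMap ℂ (W ε) (Rhat ε R))),
      Submodule.smul_mem _ _ ⟨u, rfl⟩, sub_add_cancel _ _⟩
    rw [mem_Psi_iff, map_sub, two_symb_mul, Del_sub, ← hg, Del_Mop, Aop_apply]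
    push_cast
    ring

end Complement

/-- The projection `ρ` of `W(ε)` onto `Ψ` with kernel `{w (K₀ - R̂)}`. -/
noncomputable def rho (ε R : ℝ) : W ε →ₗ[ℂ] W ε :=
  (Psi ε).projection (kerRho ε R) (isCompl_Psi_kerRho ε R)

/-! ### Conjugation, adjoint action, the inner product -/

/-- The opposite ring of `W(ε)`, seen as a complex algebra through complex conjugation. -/
def WConjOp (ε : ℝ) : Type := (W ε)ᵐᵒᵖ

noncomputable instance (ε : ℝ) : Ring (WConjOp ε) := inferInstanceAs (Ring (W ε)ᵐᵒᵖ)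

noncomputable instance (ε : ℝ) : Algebra ℂ (WConjOp ε) :=
  ((algebraMap ℂ (W ε)ᵐᵒᵖ).comp (starRingEnd ℂ)).toAlgebra' fun c x =>
    Algebra.commutes (A := (W ε)ᵐᵒᵖ) (starRingEnd ℂ c) x

theorem algebraMap_WConjOp (ε : ℝ) (c : ℂ) :
    algebraMap ℂ (WConjOp ε) c =
      MulOpposite.op (algebraMap ℂ (W ε) (starRingEnd ℂ c)) := rfl

/-- An element of `W(ε)` seen in the opposite ring. -/
def toConjOp (ε : ℝ) (w : W ε) : WConjOp ε := (MulOpposite.op w : (W ε)ᵐᵒᵖ)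

theorem toConjOp_comm (ε : ℝ) (x y : Gen) :
    toConjOp ε (gen ε (bar x)) * toConjOp ε (gen ε (bar y)) -
      toConjOp ε (gen ε (bar y)) * toConjOp ε (gen ε (bar x)) =
      toConjOp ε (if bar x = bar (bar y) then algebraMap ℂ (W ε) (ε * sgn (bar y)) else 0) := by
  rw [← gen_comm]; rfl

/-- The conjugation, as a homomorphism to the opposite ring. -/
noncomputable def dagHom (ε : ℝ) : W ε →ₐ[ℂ] WConjOp ε :=
  liftW ε (fun x => toConjOp ε (gen ε (bar x))) (by
    intro x y h
    cases h with
    | aa =>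
      rw [map_sub, map_mul, map_mul, FreeAlgebra.lift_ι_apply, FreeAlgebra.lift_ι_apply,
        AlgHom.commutes, algebraMap_WConjOp, Complex.conj_ofReal, toConjOp_comm]
      simp [bar, sgn, toConjOp]
      rfl
    | bb =>
      rw [map_sub, map_mul, map_mul, FreeAlgebra.lift_ι_apply, FreeAlgebra.lift_ι_apply,
        AlgHom.commutes, algebraMap_WConjOp, Complex.conj_ofReal, toConjOp_comm]
      simp [bar, sgn, toConjOp]
      rfl
    | ab x y hx hy =>
      rw [map_sub, map_mul, map_mul, FreeAlgebra.lift_ι_apply, FreeAlgebra.lift_ι_apply, map_zero,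
        toConjOp_comm, if_neg]
      · rfl
      · rcases hx with rfl | rfl <;> rcases hy with rfl | rfl <;> simp [bar])

/-- The conjugation `w ↦ w†`. -/
noncomputable def dag (ε : ℝ) (w : W ε) : W ε := MulOpposite.unop (dagHom ε w : (W ε)ᵐᵒᵖ)

theorem dag_mul (ε : ℝ) (u v : W ε) : dag ε (u * v) = dag ε v * dag ε u := by
  rw [dag, map_mul]; rfl

theorem dag_add (ε : ℝ) (u v : W ε) : dag ε (u + v) = dag ε u + dag ε v := by
  rw [dag, map_add]; rfl

theorem dag_algebraMap (ε : ℝ) (c : ℂ) :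
    dag ε (algebraMap ℂ (W ε) c) = algebraMap ℂ (W ε) (starRingEnd ℂ c) := by
  rw [dag, AlgHom.commutes]; rfl

theorem dag_gen (ε : ℝ) (x : Gen) : dag ε (gen ε x) = gen ε (bar x) := by
  rw [dag, dagHom, liftW_gen]; rfl

/-- The adjoint action `Ad_T w = [T, w]`. -/
noncomputable def Ad (ε : ℝ) (T : W ε) : W ε →ₗ[ℂ] W ε :=
  LinearMap.mulLeft ℂ T - LinearMap.mulRight ℂ T

theorem Ad_apply (ε : ℝ) (T w : W ε) : Ad ε T w = T * w - w * T := rfl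

/-- `Δ = Ad_{J₀} Ad_{J₀} + ½ Ad_{J₊} Ad_{J₋} + ½ Ad_{J₋} Ad_{J₊}`. -/
noncomputable def Delta (ε : ℝ) : W ε →ₗ[ℂ] W ε :=
  Ad ε (J0 ε) ∘ₗ Ad ε (J0 ε) + (1 / 2 : ℂ) • (Ad ε (Jp ε) ∘ₗ Ad ε (Jm ε)) +
    (1 / 2 : ℂ) • (Ad ε (Jm ε) ∘ₗ Ad ε (Jp ε))

/-- `π₀`: the component of degree zero with respect to the decomposition into homogeneous symmetric
polynomials, identified with a complex number. -/
noncomputable def pi0 (ε : ℝ) : W ε →ₗ[ℂ] ℂ := (basisS ε).coord 0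

/-- The sesquilinear form `⟨ξ, ζ⟩ = π₀(ρ(ξ† ζ))`. -/
noncomputable def innerProd (ε R : ℝ) (ξ ζ : W ε) : ℂ := pi0 ε (rho ε R (dag ε ξ * ζ))

/-- `‖ζ‖² = ⟨ζ, ζ⟩` (which need not be nonnegative). -/
noncomputable def normSq (ε R : ℝ) (ζ : W ε) : ℂ := innerProd ε R ζ ζ

/-! ### The basis elements `P(n,r,m)` -/

/-- The derivation `ε⁻¹ Ad_{J₋}` of `W(ε)`, which still makes sense for `ε = 0`, on the generators:
`a₊ ↦ b₊`, `b₋ ↦ -a₋`, `a₋ ↦ 0`, `b₊ ↦ 0`. -/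
noncomputable def adJmGen (ε : ℝ) : Gen → W ε
  | aM => 0
  | aP => gen ε bP
  | bM => -gen ε aM
  | bP => 0

/-- The homomorphism `w ↦ w + D(w) η` to the dual numbers (`η² = 0`) which encodes the derivation
`D` of `W(ε)` with the values `adJmGen` on the generators. -/
noncomputable def adJmHom (ε : ℝ) : W ε →ₐ[ℂ] DualNumber (W ε) :=
  liftW ε (fun x => (TrivSqZeroExt.inl (gen ε x) + TrivSqZeroExt.inr (adJmGen ε x) :
      TrivSqZeroExt (W ε) (W ε))) (by
    have hc : ∀ x y : Gen, gen ε x * gen ε y = gen ε y * gen ε x +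
        if y = bar x then algebraMap ℂ (W ε) (ε * sgn x) else 0 :=
      fun x y => by rw [← gen_comm, add_sub_cancel]
    intro x y h
    cases h with
    | aa =>
      ext <;> simp [adJmGen, TrivSqZeroExt.algebraMap_eq_inl', hc aM aP, hc aM bP, bar, sgn]
    | bb =>
      ext <;> simp [adJmGen, TrivSqZeroExt.algebraMap_eq_inl', hc bM bP, hc aM bP, bar, sgn]
    | ab x y hx hy =>
      rcases hx with rfl | rfl <;> rcases hy with rfl | rfl <;> ext <;>
        simp [adJmGen, hc aM bM, hc aM bP, hc aP bM, hc aP bP, hc aM aP, hc bM bP, bar, sgn] <;> abel)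

/-- The operator `ε⁻¹ Ad_{J₋}` on `W(ε)`, extended to `ε = 0` by the limit `ε → 0`, which is the
derivation `b₊ ∂/∂a₊ - a₋ ∂/∂b₋`. -/
noncomputable def adJm (ε : ℝ) : W ε →ₗ[ℂ] W ε where
  toFun w := TrivSqZeroExt.snd (adJmHom ε w)
  map_add' u v := by rw [map_add, TrivSqZeroExt.snd_add]
  map_smul' c u := by rw [map_smul, TrivSqZeroExt.snd_smul, RingHom.id_apply]


theorem adJm_gen (ε : ℝ) (x : Gen) : adJm ε (gen ε x) = adJmGen ε x := by
  change TrivSqZeroExt.snd (adJmHom ε (gen ε x)) = _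
  rw [adJmHom, liftW_gen]
  simp

theorem fst_adJmHom (ε : ℝ) (w : W ε) : TrivSqZeroExt.fst (adJmHom ε w) = w := by
  induction w using W_induction with
  | scal c => rw [AlgHom.commutes]; rfl
  | g x => rw [adJmHom, liftW_gen]; simp
  | mul u v hu hv => rw [map_mul, TrivSqZeroExt.fst_mul, hu, hv]
  | add u v hu hv => rw [map_add, TrivSqZeroExt.fst_add, hu, hv]

theorem adJm_mul (ε : ℝ) (u v : W ε) : adJm ε (u * v) = u * adJm ε v + adJm ε u * v := by
  change TrivSqZeroExt.snd (adJmHom ε (u * v)) = _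
  rw [map_mul, TrivSqZeroExt.snd_mul, fst_adJmHom, fst_adJmHom]
  rfl

theorem smul_adJm (ε : ℝ) (w : W ε) : (ε : ℂ) • adJm ε w = Ad ε (Jm ε) w := by
  have hc : ∀ x y : Gen, gen ε x * gen ε y = gen ε y * gen ε x +
      if y = bar x then algebraMap ℂ (W ε) (ε * sgn x) else 0 :=
    fun x y => by rw [← gen_comm, add_sub_cancel]
  induction w using W_induction with
  | scal c =>
    have : adJm ε (algebraMap ℂ (W ε) c) = 0 := by
      change TrivSqZeroExt.snd (adJmHom ε _) = _
      rw [AlgHom.commutes]; rfl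
    rw [this, Ad_apply, Algebra.commutes, sub_self, smul_zero]
  | g x =>
    have h : Ad ε (Jm ε) (gen ε x) =
        gen ε aM * (gen ε bP * gen ε x - gen ε x * gen ε bP) +
        (gen ε aM * gen ε x - gen ε x * gen ε aM) * gen ε bP := by
      rw [Ad_apply, Jm]; noncomm_ring
    rw [adJm_gen, h, gen_comm, gen_comm]
    cases x <;> simp [adJmGen, bar, sgn, Algebra.algebraMap_eq_smul_one]
  | mul u v hu hv =>
    rw [adJm_mul, smul_add, ← mul_smul_comm, ← smul_mul_assoc, hu, hv]
    simp only [Ad_apply]; noncomm_ring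
  | add u v hu hv => rw [map_add, map_add, smul_add, hu, hv]

/-- `2 n` and `n + r` are integers and `|r| ≤ n`. -/
def Adm (n r : ℚ) : Prop := (∃ a : ℤ, 2 * n = a) ∧ (∃ b : ℤ, n + r = b) ∧ |r| ≤ n

open Classical in
/-- The basis element
`P(n,r,m) = ε^(m-n) ((n+m)! / ((2n)! (n-m)!))^(1/2) (Ad_{J₋})^(n-m) (a₊^(n+r) b₋^(n-r))`
(with the limit for `ε = 0`), and zero for indices out of range. -/
noncomputable def P (ε : ℝ) (n r m : ℚ) : W ε :=
  if Adm n r ∧ Adm n m then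
    ((√((Nat.factorial ⌊n + m⌋₊ : ℝ) /
        ((Nat.factorial ⌊2 * n⌋₊ : ℝ) * (Nat.factorial ⌊n - m⌋₊ : ℝ))) : ℝ) : ℂ) •
      ((adJm ε) ^ ⌊n - m⌋₊) (gen ε aP ^ ⌊n + r⌋₊ * gen ε bM ^ ⌊n - r⌋₊)
  else 0

/-- For `ε ≠ 0` the basis elements are given by the powers of `Ad_{J₋}` itself. -/
theorem P_eq (ε : ℝ) (hε : ε ≠ 0) (n r m : ℚ) (hr : Adm n r) (hm : Adm n m) :
    P ε n r m = (((ε ^ ⌊n - m⌋₊)⁻¹ * √((Nat.factorial ⌊n + m⌋₊ : ℝ) /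
        ((Nat.factorial ⌊2 * n⌋₊ : ℝ) * (Nat.factorial ⌊n - m⌋₊ : ℝ))) : ℝ) : ℂ) •
      ((Ad ε (Jm ε)) ^ ⌊n - m⌋₊) (gen ε aP ^ ⌊n + r⌋₊ * gen ε bM ^ ⌊n - r⌋₊) := by
  have h : Ad ε (Jm ε) = (ε : ℂ) • adJm ε := LinearMap.ext fun w => (smul_adJm ε w).symm
  have hε' : (ε : ℂ) ≠ 0 := by exact_mod_cast hε
  rw [P, if_pos ⟨hr, hm⟩, h, smul_pow, LinearMap.smul_apply, smul_smul]
  congr 1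
  push_cast
  field_simp

/-- `ω_n^{r₁ r₂}(ξ) = ∑_{m=-n}^{n} ρ(P(n,r₂,m)† ξ P(n,r₁,m))`. -/
noncomputable def omegaMap (ε R : ℝ) (n r₁ r₂ : ℚ) (ξ : W ε) : W ε :=
  ∑ k ∈ Finset.range (⌊2 * n⌋₊ + 1),
    rho ε R (dag ε (P ε n r₂ (-n + k)) * ξ * P ε n r₁ (-n + k))

end FuzzySphere

open FuzzySphere

/-! The argument is representation theory of `sl₂`, carried out uniformly in `ε`. Through the Weyl
symbol `symb`, `W(ε)` becomes the polynomial space `V`, and a linear vector field on `V` whose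
matrix is infinitesimally symplectic is a derivation of the noncommutative product as well
(`derW_mul`). The matrices `matM`, `matP`, `mat0`, `matK` give derivations `D₋`, `D₊`, `D₀`, `D_K`
with `Ad_{J₋} = ε D₋` and similarly for the others. These derivations stay nonzero at `ε = 0`, so no
case distinction or limit is needed.

On symbols `Ψ` is the kernel of the Laplacian `Del`, which commutes with the four vector fields.
Since the four derivations also kill `K₀`, they preserve both summands of `W = Ψ ⊕ {w(K₀ - R̂)}` and
hence commute with `ρ` (`derW_rho`).

With the chosen normalization, `D₊` and `D₋` act on `P(n,r,·)` by mutually transposed real matrices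
whose entries do not depend on `r`. As `†` exchanges `D₊` and `D₋` up to sign, the terms by which
`D±` could fail to commute with `ω` telescope over `m` (`derW_matM_omegaMap`, `derW_matP_omegaMap`).
The case of `D₀` follows from `[D₊, D₋] = 2 D₀`, and `D_K` adds the weight `r₁ - r₂` to each
summand.

The action on the multiplets is then an instance of Schur's lemma. A harmonic polynomial killed by
`D₊` involves only `a₊` and `b₋` (`pderiv_eq_zero_of_highest`), so the weights for `D₀` and `D_K`
determine it up to a scalar. Thus `ω` maps each highest weight vector to a multiple of another one
or to zero, and powers of `D₋` carry the same scalar down the multiplet (`omegaMap_P`). The value at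
`1` is the case of the trivial multiplet. Its constant is a sum of norms, which are all equal
because `π₀ ∘ ρ` vanishes on the image of `D₊` (`normSq_basisP`). -/

namespace FuzzySphere

open Gen

/-! ### Linear vector fields on symbols -/

section LinearVectorFields

open MvPolynomial

/-- The derivation of the polynomial algebra with `x ↦ ∑ y, A x y * y` on the letters. -/
noncomputable def linDer (A : Gen → Gen → ℂ) : Derivation ℂ V V :=
  mkDerivation ℂ fun x => ∑ y, C (A x y) * X y

theorem linDer_X (A : Gen → Gen → ℂ) (x : Gen) :
    linDer A (X x) = ∑ y, C (A x y) * X y := mkDerivation_X ..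

theorem sum_derivation_apply (D : Gen → Derivation ℂ V V) (p : V) :
    (∑ x, D x) p = ∑ x, D x p := by
  simp only [Gen.sum_eq, Derivation.add_apply]

theorem linDer_apply (A : Gen → Gen → ℂ) (p : V) :
    linDer A p = ∑ x, (∑ y, C (A x y) * X y) * pderiv x p := by
  have h : linDer A = ∑ x, (∑ y, C (A x y) * X y : V) • pderiv (R := ℂ) x := by
    refine derivation_ext fun z => ?_
    rw [linDer_X, sum_derivation_apply]
    simp [pderiv_X, Pi.single_apply]
  conv_lhs => rw [h, sum_derivation_apply]
  rfl

theorem pderiv_linDer (A : Gen → Gen → ℂ) (z : Gen) (p : V) :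
    pderiv z (linDer A p) = linDer A (pderiv z p) + ∑ x, C (A x z) * pderiv x p := by
  have h : ⁅pderiv (R := ℂ) z, linDer A⁆ = ∑ x, (C (A x z) : V) • pderiv (R := ℂ) x := by
    refine derivation_ext fun w => ?_
    rw [Derivation.commutator_apply, linDer_X, pderiv_X, sum_derivation_apply]
    simp [pderiv_X, Pi.single_apply, apply_ite (linDer A)]
  have h' := congrArg (fun D => D p) h
  rw [Derivation.commutator_apply, sub_eq_iff_eq_add'] at h'
  rw [h', sum_derivation_apply]
  rfl

/-- Every term carries a letter as a factor. This makes `π₀` an invariant functional. -/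
theorem coeff_zero_linDer (A : Gen → Gen → ℂ) (p : V) : coeff 0 (linDer A p) = 0 := by
  rw [linDer_apply, ← constantCoeff_eq]
  simp

/-- The matrix `A` is infinitesimally symplectic for the form given by the commutators. -/
def IsSymplectic (A : Gen → Gen → ℂ) : Prop :=
  ∀ x z, sgn x * A z (bar x) = sgn z * A x (bar z)

/-- The product part of `Rop` obeys the Leibniz rule for any `A`. The derivative part contributes
the commutator of the vector field with `∂/∂(bar x)`, and the symplectic condition is what turns
that into the derivative parts of the `Rop ε y`. -/
theorem linDer_Rop (ε : ℝ) {A : Gen → Gen → ℂ} (hA : IsSymplectic A) (x : Gen) (p : V) :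
    linDer A (Rop ε x p) = Rop ε x (linDer A p) + ∑ y, C (A x y) * Rop ε y p := by
  have hC : ∀ c : ℂ, linDer A (C c) = 0 := fun c => (linDer A).map_algebraMap c
  have h1 : ∀ z, C (A z (bar x)) * C (sgn x) = (C (A x (bar z)) * C (sgn z) : V) := fun z => by
    rw [← C_mul, ← C_mul, mul_comm, hA x z, mul_comm]
  simp only [Rop_apply, map_sub, Derivation.leibniz, smul_eq_mul, linDer_X, hC, mul_zero, add_zero,
    pderiv_linDer, C_mul]
  have h2 : C ((ε : ℂ) / 2) * C (sgn x) * ∑ z, C (A z (bar x)) * pderiv z p =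
      - ∑ y, C (A x y) * (C ((ε : ℂ) / 2) * C (sgn y) * pderiv (bar y) p) := by
    rw [Finset.mul_sum, ← Finset.sum_neg_distrib]
    have : ∀ z, C ((ε : ℂ) / 2) * C (sgn x) * (C (A z (bar x)) * pderiv z p) =
        C ((ε : ℂ) / 2) * pderiv z p * (C (A x (bar z)) * C (sgn z)) := fun z => by
      rw [← h1]; ring
    simp only [this]
    -- Reindexing by `z = bar y` produces the minus sign, since `sgn (bar y) = -sgn y`.
    simp only [Gen.sum_eq, bar, sgn, map_neg, map_one]
    ring
  simp only [mul_sub, Finset.sum_sub_distrib, mul_add, h2]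
  simp only [← mul_assoc, ← Finset.sum_mul]
  ring

/-- `a₊ ↦ b₊`, `b₋ ↦ -a₋`. -/
def matM : Gen → Gen → ℂ
  | aP, bP => 1
  | bM, aM => -1
  | _, _ => 0

/-- `b₊ ↦ a₊`, `a₋ ↦ -b₋`. -/
def matP : Gen → Gen → ℂ
  | bP, aP => 1
  | aM, bM => -1
  | _, _ => 0

/-- The diagonal matrix of the weights with respect to `J₀`. -/
noncomputable def mat0 : Gen → Gen → ℂ
  | aP, aP => 1 / 2
  | aM, aM => -(1 / 2)
  | bP, bP => -(1 / 2)
  | bM, bM => 1 / 2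
  | _, _ => 0

/-- The diagonal matrix of the weights with respect to `K₀`. -/
noncomputable def matK : Gen → Gen → ℂ
  | aP, aP => 1 / 2
  | aM, aM => -(1 / 2)
  | bP, bP => 1 / 2
  | bM, bM => -(1 / 2)
  | _, _ => 0

theorem isSymplectic_matM : IsSymplectic matM := by
  intro x z; cases x <;> cases z <;> simp [matM, bar, sgn]

theorem isSymplectic_matP : IsSymplectic matP := by
  intro x z; cases x <;> cases z <;> simp [matP, bar, sgn]

theorem isSymplectic_mat0 : IsSymplectic mat0 := by
  intro x z; cases x <;> cases z <;> simp [mat0, bar, sgn]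

theorem isSymplectic_matK : IsSymplectic matK := by
  intro x z; cases x <;> cases z <;> simp [matK, bar, sgn]

/-- The second summand is the second-order part of the commutator. For each of the four matrices it
cancels by the symmetry of mixed partial derivatives. -/
theorem Del_linDer (A : Gen → Gen → ℂ) (p : V) :
    Del (linDer A p) = linDer A (Del p) + ∑ x, (C (A x aM) * pderiv x (pderiv aP p) +
      C (A x aP) * pderiv x (pderiv aM p) + C (A x bM) * pderiv x (pderiv bP p) +
      C (A x bP) * pderiv x (pderiv bM p)) := by
  simp only [Del, pderiv_linDer, map_add, pderiv_C_mul, Gen.sum_eq,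
    pderiv_comm' aP aM, pderiv_comm' bM aM, pderiv_comm' bP aM, pderiv_comm' bM aP,
    pderiv_comm' bP aP, pderiv_comm' bP bM]
  ring

theorem Del_linDer_matM (p : V) : Del (linDer matM p) = linDer matM (Del p) := by
  rw [Del_linDer]
  simp [Gen.sum_eq, matM, pderiv_comm' bM aP]

theorem Del_linDer_matP (p : V) : Del (linDer matP p) = linDer matP (Del p) := by
  rw [Del_linDer]
  simp [Gen.sum_eq, matP, pderiv_comm' bP aM]

theorem Del_linDer_mat0 (p : V) : Del (linDer mat0 p) = linDer mat0 (Del p) := by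
  rw [Del_linDer]
  simp only [Gen.sum_eq, mat0, map_neg, map_zero, pderiv_comm' aP aM, pderiv_comm' bP bM]
  ring

theorem Del_linDer_matK (p : V) : Del (linDer matK p) = linDer matK (Del p) := by
  rw [Del_linDer]
  simp only [Gen.sum_eq, matK, map_neg, map_zero, pderiv_comm' aP aM, pderiv_comm' bP bM]
  ring

/-! ### Harmonic highest weight polynomials -/

theorem coeff_X_mul_pderiv (i : Gen) (p : V) (m : Gen →₀ ℕ) :
    coeff m (X i * pderiv i p) = (m i : ℂ) * coeff m p := by
  induction p using MvPolynomial.induction_on' with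
  | monomial u a =>
    rw [X_mul_pderiv_monomial, coeff_smul, coeff_monomial]
    split_ifs with h
    · rw [h, nsmul_eq_mul]
    · simp
  | add p q hp hq => rw [map_add, mul_add, coeff_add, hp, hq, coeff_add, mul_add]

/-- The operator multiplies the coefficient at `m` by `1 + m i + m j`, which is never zero. -/
theorem eq_zero_of_add_X_mul_pderiv {i j : Gen} {p : V}
    (h : p + X i * pderiv i p + X j * pderiv j p = 0) : p = 0 := by
  ext m
  have h1 := congrArg (coeff m) h
  rw [coeff_add, coeff_add, coeff_X_mul_pderiv, coeff_X_mul_pderiv, coeff_zero] at h1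
  have h2 : ((1 + m i + m j : ℕ) : ℂ) * coeff m p = 0 := by
    push_cast; linear_combination h1
  rw [coeff_zero]
  exact (mul_eq_zero.1 h2).resolve_left (by exact_mod_cast (by omega))

/-- A harmonic polynomial killed by the raising operator does not contain `a₋` and `b₊`. -/
theorem pderiv_eq_zero_of_highest {f : V} (h1 : Del f = 0) (h2 : linDer matP f = 0) :
    pderiv bP f = 0 ∧ pderiv aM f = 0 := by
  have h3 : X aP * pderiv bP f - X bM * pderiv aM f = 0 := by
    rw [← h2, linDer_apply]
    simp only [Gen.sum_eq, matP, map_neg, map_zero, map_one]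
    ring
  have h4 := congrArg (pderiv aP) h3
  have h5 := congrArg (pderiv bM) h3
  have h6 := congrArg (pderiv bP) h1
  have h7 := congrArg (pderiv aM) h1
  simp only [Del, map_add, map_sub, map_zero, pderiv_mul, pderiv_X_self, zero_mul, zero_add,
    one_mul, pderiv_X_of_ne (show bM ≠ aP by decide), pderiv_X_of_ne (show aP ≠ bM by decide),
    pderiv_comm' aP aM, pderiv_comm' bM aM, pderiv_comm' bP aM, pderiv_comm' bP aP,
    pderiv_comm' bP bM] at h1 h4 h5 h6 h7
  -- Differentiating `h3` in `a₊` and replacing the mixed derivative by means of harmonicity gives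
  -- `(1 + E) (∂f/∂b₊) = 0`, where `E` is the Euler operator in `a₊` and `b₋`. Differentiating in
  -- `b₋` gives the same equation for `∂f/∂a₋`.
  refine ⟨eq_zero_of_add_X_mul_pderiv (i := aP) (j := bM) ?_,
    eq_zero_of_add_X_mul_pderiv (i := aP) (j := bM) ?_⟩
  · simp only [pderiv_comm' aP bP, pderiv_comm' bM bP]
    rw [pderiv_comm' bP aP, pderiv_comm' bP bM]
    linear_combination h4 + X bM * h1
  · rw [pderiv_comm' aP aM, pderiv_comm' bM aM]
    linear_combination -h5 + X aP * h1

/-- The harmonic highest weight vectors are the monomials in `a₊` and `b₋`. -/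
theorem coeff_eq_zero_of_highest {f : V} (h1 : Del f = 0) (h2 : linDer matP f = 0) {n r : ℂ}
    (h3 : linDer mat0 f = C n * f) (h4 : linDer matK f = C r * f) (m : Gen →₀ ℕ)
    (hm : coeff m f ≠ 0) :
    m aM = 0 ∧ m bP = 0 ∧ (m aP : ℂ) = n + r ∧ (m bM : ℂ) = n - r := by
  obtain ⟨h5, h6⟩ := pderiv_eq_zero_of_highest h1 h2
  -- Once `a₋` and `b₊` are gone, the two weights are half the sum and half the difference of the
  -- degrees in `a₊` and `b₋`.
  have h7 : C (1 / 2) * (X aP * pderiv aP f) + C (1 / 2) * (X bM * pderiv bM f) = C n * f := by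
    rw [← h3, linDer_apply]
    simp only [Gen.sum_eq, mat0, map_zero, h5, h6]
    ring
  have h8 : C (1 / 2) * (X aP * pderiv aP f) - C (1 / 2) * (X bM * pderiv bM f) = C r * f := by
    rw [← h4, linDer_apply]
    simp only [Gen.sum_eq, matK, map_zero, map_neg, h5, h6]
    ring
  have h9 := coeff_X_mul_pderiv aM f m
  have h10 := coeff_X_mul_pderiv bP f m
  rw [h6, mul_zero, coeff_zero] at h9
  rw [h5, mul_zero, coeff_zero] at h10
  have h11 := congrArg (coeff m) h7
  have h12 := congrArg (coeff m) h8
  simp only [coeff_add, coeff_sub, coeff_C_mul, coeff_X_mul_pderiv] at h11 h12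
  refine ⟨?_, ?_, mul_right_cancel₀ hm ?_, mul_right_cancel₀ hm ?_⟩
  · exact_mod_cast (mul_eq_zero.1 h9.symm).resolve_right hm
  · exact_mod_cast (mul_eq_zero.1 h10.symm).resolve_right hm
  · linear_combination h11 + h12
  · linear_combination h11 - h12

end LinearVectorFields

/-! ### The derivations of the Weyl algebra given by symplectic matrices -/

section Derivations

open MvPolynomial

/-- The linear vector field with matrix `A`, acting on `W(ε)` through symbols. -/
noncomputable def derW (ε : ℝ) (A : Gen → Gen → ℂ) : W ε →ₗ[ℂ] W ε :=
  (LinearEquiv.ofBijective (symb ε) (symb_bijective ε)).symm.toLinearMap ∘ₗ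
    (linDer A).toLinearMap ∘ₗ symb ε

theorem symb_derW (ε : ℝ) (A : Gen → Gen → ℂ) (w : W ε) :
    symb ε (derW ε A w) = linDer A (symb ε w) :=
  (LinearEquiv.ofBijective (symb ε) (symb_bijective ε)).apply_symm_apply _

theorem symb_gen (ε : ℝ) (x : Gen) : symb ε (gen ε x) = X x := by
  rw [symb_apply, rep_gen, Lop_apply]; simp

theorem symb_one (ε : ℝ) : symb ε 1 = 1 := by rw [symb_apply, map_one (rep ε)]; rfl

theorem derW_gen (ε : ℝ) (A : Gen → Gen → ℂ) (x : Gen) :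
    derW ε A (gen ε x) = ∑ y, A x y • gen ε y := by
  refine (symb_bijective ε).1 ?_
  simp [symb_derW, symb_gen, linDer_X, smul_eq_C_mul]

theorem derW_one (ε : ℝ) (A : Gen → Gen → ℂ) : derW ε A 1 = 0 := by
  refine (symb_bijective ε).1 ?_
  rw [symb_derW, symb_one, Derivation.map_one_eq_zero, map_zero]

theorem derW_algebraMap (ε : ℝ) (A : Gen → Gen → ℂ) (c : ℂ) :
    derW ε A (algebraMap ℂ (W ε) c) = 0 := by
  rw [Algebra.algebraMap_eq_smul_one, map_smul, derW_one, smul_zero]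

theorem derW_mul_gen (ε : ℝ) {A : Gen → Gen → ℂ} (hA : IsSymplectic A) (u : W ε) (x : Gen) :
    derW ε A (u * gen ε x) = u * derW ε A (gen ε x) + derW ε A u * gen ε x := by
  refine (symb_bijective ε).1 ?_
  rw [symb_derW, symb_mul_gen, linDer_Rop ε hA, map_add, symb_mul_gen, symb_derW, derW_gen,
    Finset.mul_sum, map_sum, add_comm]
  simp [symb_mul_gen, smul_eq_C_mul]

/-- Right multiplication by a letter is `Rop` on symbols, so `linDer_Rop` is the Leibniz rule for a
letter as right factor. Associativity extends it to arbitrary right factors, which is why the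
induction keeps `u` general. -/
theorem derW_mul (ε : ℝ) {A : Gen → Gen → ℂ} (hA : IsSymplectic A) (u v : W ε) :
    derW ε A (u * v) = u * derW ε A v + derW ε A u * v := by
  induction v using W_induction generalizing u with
  | scal c =>
    rw [derW_algebraMap, mul_zero, zero_add, ← Algebra.commutes, ← Algebra.commutes,
      ← Algebra.smul_def, ← Algebra.smul_def, map_smul]
  | g x => exact derW_mul_gen ε hA u x
  | mul s t hs ht =>
    rw [← mul_assoc, ht, hs, ht s]
    noncomm_ring
  | add s t hs ht => rw [mul_add, map_add, hs, ht, map_add]; noncomm_ring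

/-- A derivation is determined by the generators. All identities between derivations below,
including the commutation relations, reduce to this check on four letters. -/
theorem leibniz_ext (ε : ℝ) {D E : W ε →ₗ[ℂ] W ε}
    (hD : ∀ u v, D (u * v) = u * D v + D u * v) (hE : ∀ u v, E (u * v) = u * E v + E u * v)
    (h : ∀ x, D (gen ε x) = E (gen ε x)) : D = E := by
  have one : ∀ F : W ε →ₗ[ℂ] W ε, (∀ u v, F (u * v) = u * F v + F u * v) → F 1 = 0 := by
    intro F hF
    simpa using hF 1 1
  refine LinearMap.ext fun w => ?_
  induction w using W_induction with
  | scal c => rw [Algebra.algebraMap_eq_smul_one, map_smul, map_smul, one D hD, one E hE]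
  | g x => exact h x
  | mul u v hu hv => rw [hD, hE, hu, hv]
  | add u v hu hv => rw [map_add, map_add, hu, hv]

theorem Ad_mul (ε : ℝ) (T u v : W ε) : Ad ε T (u * v) = u * Ad ε T v + Ad ε T u * v := by
  simp only [Ad_apply]; noncomm_ring

/-- This places the operator that defines `P` among the vector fields, at `ε = 0` too. -/
theorem adJm_eq_derW (ε : ℝ) : adJm ε = derW ε matM := by
  refine leibniz_ext ε (adJm_mul ε) (derW_mul ε isSymplectic_matM) fun x => ?_
  rw [adJm_gen, derW_gen]
  cases x <;> simp [adJmGen, Gen.sum_eq, matM]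

theorem Ad_mul_left (ε : ℝ) (S T u : W ε) : Ad ε (S * T) u = S * Ad ε T u + Ad ε S u * T := by
  simp only [Ad_apply]; noncomm_ring

/-- The adjoint action is a multiple of `ε`, and the quotient makes sense for every `ε`. Statements
proved for `derW` therefore transfer to `Ad` by multiplying with `ε`. -/
theorem Ad_eq_derW (ε : ℝ) {T : W ε} {A : Gen → Gen → ℂ} (hA : IsSymplectic A)
    (h : ∀ x, Ad ε T (gen ε x) = (ε : ℂ) • ∑ y, A x y • gen ε y) :
    Ad ε T = (ε : ℂ) • derW ε A := by
  refine leibniz_ext ε (Ad_mul ε T) (fun u v => ?_) fun x => ?_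
  · simp only [LinearMap.smul_apply, derW_mul ε hA, smul_add, mul_smul_comm, smul_mul_assoc]
  · rw [h, LinearMap.smul_apply, derW_gen]

theorem Ad_gen_gen (ε : ℝ) (x y : Gen) : Ad ε (gen ε x) (gen ε y) =
    if y = bar x then algebraMap ℂ (W ε) (ε * sgn x) else 0 := gen_comm ε x y

theorem Ad_Jm (ε : ℝ) : Ad ε (Jm ε) = (ε : ℂ) • derW ε matM := by
  refine Ad_eq_derW ε isSymplectic_matM fun x => ?_
  rw [Jm, Ad_mul_left, Ad_gen_gen, Ad_gen_gen]
  cases x <;> simp [Gen.sum_eq, matM, bar, sgn, Algebra.algebraMap_eq_smul_one]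

theorem Ad_Jp (ε : ℝ) : Ad ε (Jp ε) = (ε : ℂ) • derW ε matP := by
  refine Ad_eq_derW ε isSymplectic_matP fun x => ?_
  rw [Jp, Ad_mul_left, Ad_gen_gen, Ad_gen_gen]
  cases x <;> simp [Gen.sum_eq, matP, bar, sgn, Algebra.algebraMap_eq_smul_one]

theorem Ad_J0_apply (ε : ℝ) (w : W ε) : Ad ε (J0 ε) w = (1 / 2 : ℂ) •
    (Ad ε (gen ε aP * gen ε aM) w - Ad ε (gen ε bP * gen ε bM) w) := by
  simp only [Ad_apply, J0, smul_mul_assoc, mul_smul_comm, ← smul_sub]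
  congr 1
  noncomm_ring

theorem Ad_K0_apply (ε : ℝ) (w : W ε) : Ad ε (K0 ε) w = (1 / 2 : ℂ) •
    (Ad ε (gen ε aP * gen ε aM) w + Ad ε (gen ε bP * gen ε bM) w) := by
  simp only [Ad_apply, K0, smul_mul_assoc, mul_smul_comm, ← smul_sub, add_mul, mul_add,
    Algebra.commutes]
  congr 1
  noncomm_ring

theorem Ad_J0 (ε : ℝ) : Ad ε (J0 ε) = (ε : ℂ) • derW ε mat0 := by
  refine Ad_eq_derW ε isSymplectic_mat0 fun x => ?_
  rw [Ad_J0_apply, Ad_mul_left, Ad_mul_left]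
  simp only [Ad_gen_gen]
  cases x <;> simp [Gen.sum_eq, mat0, bar, sgn, Algebra.algebraMap_eq_smul_one] <;> module

theorem Ad_K0 (ε : ℝ) : Ad ε (K0 ε) = (ε : ℂ) • derW ε matK := by
  refine Ad_eq_derW ε isSymplectic_matK fun x => ?_
  rw [Ad_K0_apply, Ad_mul_left, Ad_mul_left]
  simp only [Ad_gen_gen]
  cases x <;> simp [Gen.sum_eq, matK, bar, sgn, Algebra.algebraMap_eq_smul_one] <;> module

/-- `[D₊, D₋] = 2 D₀`. -/
theorem derW_matP_matM (ε : ℝ) (w : W ε) :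
    derW ε matP (derW ε matM w) =
      derW ε matM (derW ε matP w) + (2 : ℂ) • derW ε mat0 w := by
  have h : derW ε matP ∘ₗ derW ε matM - derW ε matM ∘ₗ derW ε matP =
      (2 : ℂ) • derW ε mat0 := by
    refine leibniz_ext ε (fun u v => ?_) (fun u v => ?_) fun x => ?_
    · simp only [LinearMap.sub_apply, LinearMap.comp_apply, derW_mul ε isSymplectic_matP,
        derW_mul ε isSymplectic_matM, map_add]
      noncomm_ring
    · simp only [LinearMap.smul_apply, derW_mul ε isSymplectic_mat0, smul_add, mul_smul_comm,
        smul_mul_assoc]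
    · simp only [LinearMap.sub_apply, LinearMap.comp_apply, LinearMap.smul_apply, derW_gen,
        Gen.sum_eq, map_add, map_smul]
      cases x <;> simp [matP, matM, mat0]
  have := LinearMap.congr_fun h w
  rw [LinearMap.sub_apply, sub_eq_iff_eq_add'] at this
  exact this

/-- `[D₀, D₋] = -D₋`. -/
theorem derW_mat0_matM (ε : ℝ) (w : W ε) :
    derW ε mat0 (derW ε matM w) = derW ε matM (derW ε mat0 w) - derW ε matM w := by
  have h : derW ε mat0 ∘ₗ derW ε matM - derW ε matM ∘ₗ derW ε mat0 = - derW ε matM := by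
    refine leibniz_ext ε (fun u v => ?_) (fun u v => ?_) fun x => ?_
    · simp only [LinearMap.sub_apply, LinearMap.comp_apply, derW_mul ε isSymplectic_mat0,
        derW_mul ε isSymplectic_matM, map_add]
      noncomm_ring
    · simp only [LinearMap.neg_apply, derW_mul ε isSymplectic_matM]
      noncomm_ring
    · simp only [LinearMap.sub_apply, LinearMap.comp_apply, LinearMap.neg_apply, derW_gen,
        Gen.sum_eq, map_add, map_smul]
      cases x <;> simp [matM, mat0] <;> module
  have := LinearMap.congr_fun h w
  rw [LinearMap.sub_apply, sub_eq_iff_eq_add'] at this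
  exact this.trans (sub_eq_add_neg _ _).symm

/-- `[D_K, D₋] = 0`. -/
theorem derW_matK_matM (ε : ℝ) (w : W ε) :
    derW ε matK (derW ε matM w) = derW ε matM (derW ε matK w) := by
  have h : derW ε matK ∘ₗ derW ε matM - derW ε matM ∘ₗ derW ε matK = 0 := by
    refine leibniz_ext ε (fun u v => ?_) (fun u v => by simp) fun x => ?_
    · simp only [LinearMap.sub_apply, LinearMap.comp_apply, derW_mul ε isSymplectic_matK,
        derW_mul ε isSymplectic_matM, map_add]
      noncomm_ring
    · simp only [LinearMap.sub_apply, LinearMap.comp_apply, LinearMap.zero_apply, derW_gen,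
        Gen.sum_eq, map_add, map_smul]
      cases x <;> simp [matM, matK]
  have := LinearMap.congr_fun h w
  rwa [LinearMap.sub_apply, sub_eq_iff_eq_add', LinearMap.zero_apply, add_zero] at this

/-! ### Compatibility with the conjugation, with `ρ` and with `π₀` -/

theorem dag_zero (ε : ℝ) : dag ε 0 = 0 := by
  simpa using dag_algebraMap ε 0

theorem dag_smul (ε : ℝ) (c : ℂ) (w : W ε) :
    dag ε (c • w) = starRingEnd ℂ c • dag ε w := by
  rw [Algebra.smul_def, dag_mul, dag_algebraMap, ← Algebra.commutes, ← Algebra.smul_def]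

/-- The analogue of `[T, w†] = -[T†, w]†`, with the relation between `T` and `T†` expressed by the
two matrices so that it survives at `ε = 0`. -/
theorem derW_dag (ε : ℝ) {A B : Gen → Gen → ℂ} (hA : IsSymplectic A) (hB : IsSymplectic B)
    (h : ∀ x y, A (bar x) (bar y) = -starRingEnd ℂ (B x y)) (w : W ε) :
    derW ε A (dag ε w) = -dag ε (derW ε B w) := by
  induction w using W_induction with
  | scal c => rw [dag_algebraMap, derW_algebraMap, derW_algebraMap, dag_zero, neg_zero]
  | g x =>
    have hx : ∀ z, A (bar x) z = -starRingEnd ℂ (B x (bar z)) := fun z => by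
      rw [← h]; cases z <;> rfl
    simp only [dag_gen, derW_gen, Gen.sum_eq, dag_add, dag_smul, hx]
    simp only [bar]
    module
  | mul u v hu hv =>
    rw [dag_mul, derW_mul ε hA, derW_mul ε hB, dag_add, dag_mul, dag_mul, hu, hv]
    noncomm_ring
  | add u v hu hv => rw [dag_add, map_add, map_add, dag_add, hu, hv]; abel

theorem derW_matP_dag (ε : ℝ) (w : W ε) :
    derW ε matP (dag ε w) = -dag ε (derW ε matM w) :=
  derW_dag ε isSymplectic_matP isSymplectic_matM
    (fun x y => by cases x <;> cases y <;> simp [matM, matP, bar]) w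

theorem derW_matM_dag (ε : ℝ) (w : W ε) :
    derW ε matM (dag ε w) = -dag ε (derW ε matP w) :=
  derW_dag ε isSymplectic_matM isSymplectic_matP
    (fun x y => by cases x <;> cases y <;> simp [matM, matP, bar]) w

theorem derW_matK_dag (ε : ℝ) (w : W ε) :
    derW ε matK (dag ε w) = -dag ε (derW ε matK w) :=
  derW_dag ε isSymplectic_matK isSymplectic_matK
    (fun x y => by cases x <;> cases y <;> simp [matK, bar, map_ofNat]) w

theorem derW_mem_Psi (ε : ℝ) {A : Gen → Gen → ℂ}
    (h : ∀ p, Del (linDer A p) = linDer A (Del p)) {w : W ε} (hw : w ∈ Psi ε) :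
    derW ε A w ∈ Psi ε := by
  rw [mem_Psi_iff] at hw ⊢
  rw [symb_derW, h, hw, map_zero]

theorem rho_mem_Psi (ε R : ℝ) (w : W ε) : rho ε R w ∈ Psi ε :=
  Submodule.projection_apply_mem _ w

/-- A derivation that kills `K₀` also kills `K₀ - R̂`, so it maps `w(K₀ - R̂)` to `D(w)(K₀ - R̂)`.
It then preserves both summands of the decomposition that defines `ρ`. -/
theorem derW_rho (ε R : ℝ) {A : Gen → Gen → ℂ} (hA : IsSymplectic A)
    (h : ∀ p, Del (linDer A p) = linDer A (Del p)) (hK : derW ε A (K0 ε) = 0) (w : W ε) :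
    derW ε A (rho ε R w) = rho ε R (derW ε A w) := by
  obtain ⟨u, hu, k, hk, rfl⟩ : ∃ u ∈ Psi ε, ∃ k ∈ kerRho ε R, u + k = w :=
    Submodule.mem_sup.1 (by rw [(isCompl_Psi_kerRho ε R).sup_eq_top]; trivial)
  have hk' : derW ε A k ∈ kerRho ε R := by
    obtain ⟨v, rfl⟩ := hk
    refine ⟨derW ε A v, ?_⟩
    rw [LinearMap.mulRight_apply, LinearMap.mulRight_apply, derW_mul ε hA, map_sub, hK,
      derW_algebraMap, sub_zero, mul_zero, zero_add]
  have h0 : ∀ v ∈ kerRho ε R, rho ε R v = 0 := fun v hv =>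
    Submodule.projection_apply_of_mem_right _ hv
  have h1 : ∀ v ∈ Psi ε, rho ε R v = v := fun v hv =>
    Submodule.projection_apply_of_mem_left _ hv
  simp only [map_add, h0 k hk, h0 _ hk', h1 u hu, h1 _ (derW_mem_Psi ε h hu),
    add_zero]

theorem derW_K0 (ε : ℝ) {A : Gen → Gen → ℂ} (hA : IsSymplectic A) : derW ε A (K0 ε) =
    (1 / 2 : ℂ) • (gen ε aP * ∑ y, A aM y • gen ε y + (∑ y, A aP y • gen ε y) * gen ε aM +
      (gen ε bP * ∑ y, A bM y • gen ε y + (∑ y, A bP y • gen ε y) * gen ε bM)) := by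
  rw [K0, map_smul, map_add, map_add, derW_mul ε hA, derW_mul ε hA, derW_algebraMap, add_zero]
  simp only [derW_gen]

theorem derW_matM_rho (ε R : ℝ) (w : W ε) :
    derW ε matM (rho ε R w) = rho ε R (derW ε matM w) :=
  derW_rho ε R isSymplectic_matM Del_linDer_matM
    (by rw [derW_K0 ε isSymplectic_matM]; simp [Gen.sum_eq, matM]) w

theorem derW_matP_rho (ε R : ℝ) (w : W ε) :
    derW ε matP (rho ε R w) = rho ε R (derW ε matP w) :=
  derW_rho ε R isSymplectic_matP Del_linDer_matP
    (by rw [derW_K0 ε isSymplectic_matP]; simp [Gen.sum_eq, matP]) w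

theorem derW_matK_rho (ε R : ℝ) (w : W ε) :
    derW ε matK (rho ε R w) = rho ε R (derW ε matK w) :=
  derW_rho ε R isSymplectic_matK Del_linDer_matK
    (by rw [derW_K0 ε isSymplectic_matK]; simp [Gen.sum_eq, matK]) w

/-- The symbol of each basis element is a multiple of the monomial with the same exponents, and the
symbol of `1` is `1`. -/
theorem pi0_eq_coeff (ε : ℝ) (w : W ε) : pi0 ε w = coeff 0 (symb ε w) := by
  have h : pi0 ε = (lcoeff ℂ (0 : Gen →₀ ℕ)) ∘ₗ symb ε := by
    refine (basisS ε).ext fun d => ?_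
    obtain ⟨c, -, hc⟩ := symSum_X d
    rw [LinearMap.comp_apply, lcoeff_apply, symb_basisS, pi0, Module.Basis.coord_apply,
      Module.Basis.repr_self]
    by_cases hd : d = 0
    · subst hd
      rw [Finsupp.single_eq_same]
      have : symSum (X : Gen → V) (∑ x, (0 : Gen → ℕ) x) (fun x => (((0 : Gen → ℕ) x : ℕ) : ℤ)) =
          1 := by
        simp only [Pi.zero_apply, Finset.sum_const_zero]
        rw [symSum_zero, if_pos]
        rfl
      rw [this, coeff_zero_one]
    · rw [Finsupp.single_eq_of_ne (Ne.symm hd), hc, coeff_smul, coeff_monomial, if_neg, smul_zero]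
      intro h
      exact hd (funext fun x => by simpa using DFunLike.congr_fun h x)
  exact LinearMap.congr_fun h w

theorem pi0_derW (ε : ℝ) (A : Gen → Gen → ℂ) (w : W ε) : pi0 ε (derW ε A w) = 0 := by
  rw [pi0_eq_coeff, symb_derW, coeff_zero_linDer]

theorem pi0_one (ε : ℝ) : pi0 ε 1 = 1 := by
  rw [pi0_eq_coeff, symb_one, coeff_zero_one]

end Derivations

/-! ### The `sl₂` multiplets and their normalization -/

section Multiplets

/-- Pigeonhole in the Leibniz expansion: of `N = i + j - 1` derivatives, at least `i` fall on `u` or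
at least `j` fall on `v`. -/
theorem iterate_mul_eq_zero (ε : ℝ) {A : Gen → Gen → ℂ} (hA : IsSymplectic A) {N i j : ℕ}
    {u v : W ε} (hN : i + j = N + 1) (hu : (derW ε A ^ i) u = 0) (hv : (derW ε A ^ j) v = 0) :
    (derW ε A ^ N) (u * v) = 0 := by
  induction N generalizing i j u v with
  | zero =>
    have h : i = 0 ∨ j = 0 := by omega
    rcases h with rfl | rfl
    · rw [pow_zero, Module.End.one_apply] at hu; simp [hu]
    · rw [pow_zero, Module.End.one_apply] at hv; simp [hv]
  | succ N ih =>
    rcases i with _ | i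
    · rw [pow_zero, Module.End.one_apply] at hu; simp [hu]
    rcases j with _ | j
    · rw [pow_zero, Module.End.one_apply] at hv; simp [hv]
    rw [pow_succ, Module.End.mul_apply, derW_mul ε hA, map_add]
    rw [ih (i := i + 1) (j := j) (by omega) hu
        (by rw [← Module.End.mul_apply, ← pow_succ, hv]),
      ih (i := i) (j := j + 1) (by omega)
        (by rw [← Module.End.mul_apply, ← pow_succ, hu]) hv, add_zero]

theorem iterate_pow_eq_zero (ε : ℝ) {A : Gen → Gen → ℂ} (hA : IsSymplectic A) {u : W ε}
    (hu : derW ε A (derW ε A u) = 0) (k : ℕ) : (derW ε A ^ (k + 1)) (u ^ k) = 0 := by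
  induction k with
  | zero => simpa using derW_one ε A
  | succ k ih =>
    rw [pow_succ u]
    exact iterate_mul_eq_zero ε hA (j := 2) (by ring) ih (by rw [pow_two]; exact hu)

theorem derW_pow_of_eigen (ε : ℝ) {A : Gen → Gen → ℂ} (hA : IsSymplectic A) {u : W ε} {c : ℂ}
    (hu : derW ε A u = c • u) (k : ℕ) : derW ε A (u ^ k) = (k * c) • u ^ k := by
  induction k with
  | zero => simp [derW_one]
  | succ k ih =>
    rw [pow_succ, derW_mul ε hA, hu, ih, mul_smul_comm, smul_mul_assoc, ← add_smul]
    congr 1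
    push_cast
    ring

/-- The highest weight vector `a₊^p b₋^(N-p)`. -/
noncomputable def hw (ε : ℝ) (N p : ℕ) : W ε := gen ε aP ^ p * gen ε bM ^ (N - p)

theorem derW_hw_of_eigen (ε : ℝ) {A : Gen → Gen → ℂ} (hA : IsSymplectic A) {c d : ℂ}
    (hc : derW ε A (gen ε aP) = c • gen ε aP) (hd : derW ε A (gen ε bM) = d • gen ε bM)
    {N p : ℕ} (hp : p ≤ N) :
    derW ε A (hw ε N p) = (p * c + (N - p) * d) • hw ε N p := by
  rw [hw, derW_mul ε hA, derW_pow_of_eigen ε hA hc, derW_pow_of_eigen ε hA hd, mul_smul_comm,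
    smul_mul_assoc, ← add_smul]
  congr 1
  push_cast [Nat.cast_sub hp]
  ring

theorem derW_matP_hw (ε : ℝ) {N p : ℕ} (hp : p ≤ N) : derW ε matP (hw ε N p) = 0 := by
  rw [derW_hw_of_eigen ε isSymplectic_matP (c := 0) (d := 0)
    (by rw [derW_gen]; simp [matP]) (by rw [derW_gen]; simp [matP]) hp]
  simp

theorem derW_mat0_hw (ε : ℝ) {N p : ℕ} (hp : p ≤ N) :
    derW ε mat0 (hw ε N p) = (N / 2 : ℂ) • hw ε N p := by
  rw [derW_hw_of_eigen ε isSymplectic_mat0 (c := 1 / 2) (d := 1 / 2)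
    (by rw [derW_gen]; simp [Gen.sum_eq, mat0]) (by rw [derW_gen]; simp [Gen.sum_eq, mat0]) hp]
  congr 1
  ring

theorem derW_matK_hw (ε : ℝ) {N p : ℕ} (hp : p ≤ N) :
    derW ε matK (hw ε N p) = (p - N / 2 : ℂ) • hw ε N p := by
  rw [derW_hw_of_eigen ε isSymplectic_matK (c := 1 / 2) (d := -(1 / 2))
    (by rw [derW_gen]; simp [Gen.sum_eq, matK]) (by rw [derW_gen]; simp [Gen.sum_eq, matK]) hp]
  congr 1
  ring

theorem iterate_hw_eq_zero (ε : ℝ) {N p : ℕ} (hp : p ≤ N) :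
    (derW ε matM ^ (N + 1)) (hw ε N p) = 0 := by
  -- `D₋` squares to zero on the letters `a₊` and `b₋`, so `p + 1` and `N - p + 1` applications kill
  -- the two powers.
  refine iterate_mul_eq_zero ε isSymplectic_matM (i := p + 1) (j := N - p + 1) (by omega)
    (iterate_pow_eq_zero ε isSymplectic_matM ?_ _) (iterate_pow_eq_zero ε isSymplectic_matM ?_ _)
  · rw [derW_gen, map_sum]; simp [Gen.sum_eq, matM, derW_gen]
  · rw [derW_gen, map_sum]; simp [Gen.sum_eq, matM, derW_gen]

theorem derW_mat0_iterate_hw (ε : ℝ) {N p : ℕ} (hp : p ≤ N) (k : ℕ) :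
    derW ε mat0 ((derW ε matM ^ k) (hw ε N p)) =
      (N / 2 - k : ℂ) • (derW ε matM ^ k) (hw ε N p) := by
  induction k with
  | zero => simpa using derW_mat0_hw ε hp
  | succ k ih =>
    rw [pow_succ', Module.End.mul_apply, derW_mat0_matM, ih, map_smul]
    push_cast
    module

theorem derW_matK_iterate_hw (ε : ℝ) {N p : ℕ} (hp : p ≤ N) (k : ℕ) :
    derW ε matK ((derW ε matM ^ k) (hw ε N p)) =
      (p - N / 2 : ℂ) • (derW ε matM ^ k) (hw ε N p) := by
  induction k with
  | zero => simpa using derW_matK_hw ε hp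
  | succ k ih => rw [pow_succ', Module.End.mul_apply, derW_matK_matM, ih, map_smul]

/-- The usual spin `N/2` computation: commuting `D₊` past one more `D₋` adds twice the `D₀` weight,
and these weights sum to `(N - k)(k + 1)`. -/
theorem derW_matP_iterate_hw (ε : ℝ) {N p : ℕ} (hp : p ≤ N) (k : ℕ) :
    derW ε matP ((derW ε matM ^ (k + 1)) (hw ε N p)) =
      ((N - k) * (k + 1) : ℂ) • (derW ε matM ^ k) (hw ε N p) := by
  induction k with
  | zero =>
    rw [zero_add, pow_one, derW_matP_matM, derW_matP_hw ε hp, derW_mat0_hw ε hp]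
    simp only [map_zero, pow_zero, Module.End.one_apply]
    push_cast
    module
  | succ k ih =>
    rw [pow_succ' _ (k + 1), Module.End.mul_apply, derW_matP_matM, ih, derW_mat0_iterate_hw ε hp,
      map_smul, ← Module.End.mul_apply, ← pow_succ']
    push_cast
    module

/-- The normalized basis element `P(N/2, p - N/2, N/2 - k)`. -/
noncomputable def basisP (ε : ℝ) (N p k : ℕ) : W ε :=
  ((√(((N - k).factorial : ℝ) / ((N.factorial : ℝ) * (k.factorial : ℝ))) : ℝ) : ℂ) •
    (derW ε matM ^ k) (hw ε N p)

/-- The matrix elements of the ladder operators. -/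
noncomputable def ladder (N k : ℕ) : ℝ := √(((N - k : ℕ) : ℝ) * (k + 1))

theorem basisP_zero (ε : ℝ) (N p : ℕ) : basisP ε N p 0 = hw ε N p := by
  have : (N.factorial : ℝ) ≠ 0 := by exact_mod_cast N.factorial_ne_zero
  simp [basisP, this]

theorem basisP_eq_zero (ε : ℝ) {N p : ℕ} (hp : p ≤ N) : basisP ε N p (N + 1) = 0 := by
  rw [basisP, iterate_hw_eq_zero ε hp, smul_zero]

theorem ladder_self (N : ℕ) : ladder N N = 0 := by simp [ladder]

theorem ladder_ne_zero {N k : ℕ} (h : k < N) : ladder N k ≠ 0 := by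
  have : 0 < N - k := by omega
  rw [ladder]
  positivity

/-- The square roots split the factor `(N - k)(k + 1)` evenly, so that lowering and raising have the
same matrix element `ladder N k`. -/
theorem normalization_eq {N k : ℕ} (h : k < N) :
    √(((N - k).factorial : ℝ) / ((N.factorial : ℝ) * (k.factorial : ℝ))) =
      ladder N k *
        √(((N - (k + 1)).factorial : ℝ) / ((N.factorial : ℝ) * ((k + 1).factorial : ℝ))) := by
  rw [ladder, ← Real.sqrt_mul (by positivity)]
  congr 1
  obtain ⟨j, rfl⟩ : ∃ j, N = k + 1 + j := ⟨N - (k + 1), by omega⟩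
  rw [show k + 1 + j - k = j + 1 by omega, Nat.add_sub_cancel_left, Nat.factorial_succ,
    Nat.factorial_succ k]
  push_cast
  field_simp

theorem derW_matM_basisP (ε : ℝ) {N p k : ℕ} (hp : p ≤ N) (hk : k ≤ N) :
    derW ε matM (basisP ε N p k) = (ladder N k : ℂ) • basisP ε N p (k + 1) := by
  rw [basisP, map_smul, ← Module.End.mul_apply, ← pow_succ']
  -- At the bottom `k = N` both sides vanish. Including this case lets the sums below telescope
  -- without a boundary exception.
  rcases hk.eq_or_lt with rfl | hk
  · rw [iterate_hw_eq_zero ε hp, ladder_self]; simp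
  · rw [normalization_eq hk, basisP, smul_smul]
    push_cast
    rfl

theorem derW_matP_basisP (ε : ℝ) {N p k : ℕ} (hp : p ≤ N) (hk : k ≤ N) :
    derW ε matP (basisP ε N p (k + 1)) = (ladder N k : ℂ) • basisP ε N p k := by
  rcases hk.eq_or_lt with rfl | hk
  · rw [basisP_eq_zero ε hp, ladder_self]; simp
  · rw [basisP, map_smul, derW_matP_iterate_hw ε hp, basisP, normalization_eq hk, smul_smul,
      smul_smul]
    congr 1
    have h : ((N - k) * (k + 1) : ℂ) = (ladder N k : ℂ) * (ladder N k : ℂ) := by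
      rw [← Complex.ofReal_mul, ladder, Real.mul_self_sqrt (by positivity)]
      push_cast [Nat.cast_sub hk.le]
      rfl
    rw [h]
    push_cast
    ring

theorem derW_matP_basisP_zero (ε : ℝ) {N p : ℕ} (hp : p ≤ N) :
    derW ε matP (basisP ε N p 0) = 0 := by
  rw [basisP_zero, derW_matP_hw ε hp]

theorem derW_matK_basisP (ε : ℝ) {N p : ℕ} (hp : p ≤ N) (k : ℕ) :
    derW ε matK (basisP ε N p k) = (p - N / 2 : ℂ) • basisP ε N p k := by
  rw [basisP, map_smul, derW_matK_iterate_hw ε hp, smul_comm]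

/-! ### From half-integer indices to natural numbers -/

theorem Adm.exists_nat {n r : ℚ} (h : Adm n r) :
    ∃ N p : ℕ, p ≤ N ∧ n = N / 2 ∧ r = p - N / 2 := by
  obtain ⟨⟨a, ha⟩, ⟨b, hb⟩, hr⟩ := h
  rw [abs_le] at hr
  have ha0 : 0 ≤ a := by exact_mod_cast (show (0 : ℚ) ≤ a by linarith)
  have hb0 : 0 ≤ b := by exact_mod_cast (show (0 : ℚ) ≤ b by linarith)
  have hba : b ≤ a := by exact_mod_cast (show (b : ℚ) ≤ a by linarith)
  lift a to ℕ using ha0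
  lift b to ℕ using hb0
  push_cast at ha hb
  exact ⟨a, b, by exact_mod_cast hba, by linarith, by linarith⟩

theorem adm_nat {N p : ℕ} (h : p ≤ N) : Adm (N / 2) (p - N / 2) := by
  have h' : (p : ℚ) ≤ N := by exact_mod_cast h
  have h0 : (0 : ℚ) ≤ p := p.cast_nonneg
  exact ⟨⟨N, by push_cast; ring⟩, ⟨p, by push_cast; ring⟩,
    abs_le.2 ⟨by linarith, by linarith⟩⟩

theorem adm_sub_nat {N k : ℕ} (h : k ≤ N) : Adm (N / 2) (N / 2 - k) := by
  have := adm_nat (Nat.sub_le N k)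
  rw [Nat.cast_sub h] at this
  convert this using 1
  ring

theorem P_eq_basisP (ε : ℝ) {N p k : ℕ} (hp : p ≤ N) (hk : k ≤ N) :
    P ε (N / 2) (p - N / 2) (N / 2 - k) = basisP ε N p k := by
  have h1 : ⌊(N / 2 + (N / 2 - k) : ℚ)⌋₊ = N - k := by
    rw [show (N / 2 + (N / 2 - k) : ℚ) = ((N - k : ℕ) : ℚ) by push_cast [Nat.cast_sub hk]; ring,
      Nat.floor_natCast]
  have h2 : ⌊(2 * (N / 2) : ℚ)⌋₊ = N := by
    rw [show (2 * (N / 2) : ℚ) = N by ring, Nat.floor_natCast]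
  have h3 : ⌊(N / 2 - (N / 2 - k) : ℚ)⌋₊ = k := by
    rw [show (N / 2 - (N / 2 - k) : ℚ) = k by ring, Nat.floor_natCast]
  have h4 : ⌊(N / 2 + (p - N / 2) : ℚ)⌋₊ = p := by
    rw [show (N / 2 + (p - N / 2) : ℚ) = p by ring, Nat.floor_natCast]
  have h5 : ⌊(N / 2 - (p - N / 2) : ℚ)⌋₊ = N - p := by
    rw [show (N / 2 - (p - N / 2) : ℚ) = ((N - p : ℕ) : ℚ) by push_cast [Nat.cast_sub hp]; ring,
      Nat.floor_natCast]
  rw [P, if_pos ⟨adm_nat hp, adm_sub_nat hk⟩, h1, h2, h3, h4, h5, adJm_eq_derW]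
  rfl

theorem omegaMap_eq (ε R : ℝ) {N p₁ p₂ : ℕ} (h₁ : p₁ ≤ N) (h₂ : p₂ ≤ N) (ξ : W ε) :
    omegaMap ε R (N / 2) (p₁ - N / 2) (p₂ - N / 2) ξ =
      ∑ k ∈ Finset.range (N + 1),
        rho ε R (dag ε (basisP ε N p₂ k) * ξ * basisP ε N p₁ k) := by
  have h : ⌊(2 * (N / 2) : ℚ)⌋₊ = N := by
    rw [show (2 * (N / 2) : ℚ) = N by ring, Nat.floor_natCast]
  -- The definition counts `m` upwards from `-n`, while `basisP` counts lowering steps downwards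
  -- from `n`.
  rw [omegaMap, h, ← Finset.sum_range_reflect]
  refine Finset.sum_congr rfl fun k hk => ?_
  have hk' : k ≤ N := by rw [Finset.mem_range] at hk; omega
  rw [show (-(N / 2) + ((N + 1 - 1 - k : ℕ) : ℚ) : ℚ) = N / 2 - k by
    rw [Nat.add_sub_cancel, Nat.cast_sub hk']; ring, P_eq_basisP ε h₁ hk', P_eq_basisP ε h₂ hk']

end Multiplets

/-! ### Equivariance of `ω` -/

section Equivariance

variable {ε R : ℝ}

theorem omegaMap_add (n r₁ r₂ : ℚ) (ξ ζ : W ε) :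
    omegaMap ε R n r₁ r₂ (ξ + ζ) = omegaMap ε R n r₁ r₂ ξ + omegaMap ε R n r₁ r₂ ζ := by
  simp only [omegaMap, mul_add, add_mul, map_add, Finset.sum_add_distrib]

theorem omegaMap_smul (n r₁ r₂ : ℚ) (c : ℂ) (ξ : W ε) :
    omegaMap ε R n r₁ r₂ (c • ξ) = c • omegaMap ε R n r₁ r₂ ξ := by
  simp only [omegaMap, mul_smul_comm, smul_mul_assoc, map_smul, Finset.smul_sum]

theorem omegaMap_mem_Psi (n r₁ r₂ : ℚ) (ξ : W ε) : omegaMap ε R n r₁ r₂ ξ ∈ Psi ε :=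
  Submodule.sum_mem _ fun _ _ => rho_mem_Psi ε R _

theorem derW_triple {A : Gen → Gen → ℂ} (hA : IsSymplectic A) (u v w : W ε) :
    derW ε A (u * v * w) =
      u * derW ε A v * w + (u * v * derW ε A w + derW ε A u * v * w) := by
  rw [derW_mul ε hA, derW_mul ε hA]
  noncomm_ring

/-- Writing `P_k` and `Q_k` for the basis elements of weights `r₁` and `r₂`, the extra terms are
`Q_k† ξ (D₋ P_k) - (D₊ Q_k)† ξ P_k`. Equal real matrix elements turn the first into `(D₊ Q_{k+1})† ξ
P_{k+1}`, so the sum telescopes. The ends vanish because `D₊ Q_0 = 0` and `P_{N+1} = 0`. -/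
theorem derW_matM_omegaMap {n r₁ r₂ : ℚ} (hr₁ : Adm n r₁) (hr₂ : Adm n r₂) (ξ : W ε) :
    derW ε matM (omegaMap ε R n r₁ r₂ ξ) = omegaMap ε R n r₁ r₂ (derW ε matM ξ) := by
  obtain ⟨N, p₁, h₁, rfl, rfl⟩ := hr₁.exists_nat
  obtain ⟨N', p₂, h₂, hN, rfl⟩ := hr₂.exists_nat
  obtain rfl : N = N' := by
    have : (N : ℚ) = N' := by linarith
    exact_mod_cast this
  have key : ∀ k ∈ Finset.range (N + 1),
      derW ε matM (rho ε R (dag ε (basisP ε N p₂ k) * ξ * basisP ε N p₁ k)) =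
      rho ε R (dag ε (basisP ε N p₂ k) * derW ε matM ξ * basisP ε N p₁ k) +
      (rho ε R (dag ε (derW ε matP (basisP ε N p₂ (k + 1))) * ξ * basisP ε N p₁ (k + 1)) -
        rho ε R (dag ε (derW ε matP (basisP ε N p₂ k)) * ξ * basisP ε N p₁ k)) := by
    intro k hk
    have hk' : k ≤ N := by rw [Finset.mem_range] at hk; omega
    rw [derW_matM_rho, derW_triple isSymplectic_matM, derW_matM_dag, derW_matM_basisP ε h₁ hk',
      derW_matP_basisP ε h₂ hk', dag_smul, Complex.conj_ofReal, map_add, ← map_sub]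
    congr 2
    simp only [mul_smul_comm, smul_mul_assoc, neg_mul, sub_eq_add_neg]
  rw [omegaMap_eq ε R h₁ h₂, omegaMap_eq ε R h₁ h₂, map_sum, Finset.sum_congr rfl key,
    Finset.sum_add_distrib, Finset.sum_range_sub (fun k =>
      rho ε R (dag ε (derW ε matP (basisP ε N p₂ k)) * ξ * basisP ε N p₁ k)),
    basisP_eq_zero ε h₁, derW_matP_basisP_zero ε h₂, dag_zero]
  simp

theorem derW_matP_omegaMap {n r₁ r₂ : ℚ} (hr₁ : Adm n r₁) (hr₂ : Adm n r₂) (ξ : W ε) :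
    derW ε matP (omegaMap ε R n r₁ r₂ ξ) = omegaMap ε R n r₁ r₂ (derW ε matP ξ) := by
  obtain ⟨N, p₁, h₁, rfl, rfl⟩ := hr₁.exists_nat
  obtain ⟨N', p₂, h₂, hN, rfl⟩ := hr₂.exists_nat
  obtain rfl : N = N' := by
    have : (N : ℚ) = N' := by linarith
    exact_mod_cast this
  -- The same telescoping with the roles exchanged: `(D₋ Q_k)† ξ P_k = Q_{k+1}† ξ (D₊ P_{k+1})`, so
  -- the differences now run in the opposite direction.
  have key : ∀ k ∈ Finset.range (N + 1),
      derW ε matP (rho ε R (dag ε (basisP ε N p₂ k) * ξ * basisP ε N p₁ k)) =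
      rho ε R (dag ε (basisP ε N p₂ k) * derW ε matP ξ * basisP ε N p₁ k) +
      (rho ε R (dag ε (basisP ε N p₂ k) * ξ * derW ε matP (basisP ε N p₁ k)) -
        rho ε R (dag ε (basisP ε N p₂ (k + 1)) * ξ * derW ε matP (basisP ε N p₁ (k + 1)))) := by
    intro k hk
    have hk' : k ≤ N := by rw [Finset.mem_range] at hk; omega
    rw [derW_matP_rho, derW_triple isSymplectic_matP, derW_matP_dag, derW_matM_basisP ε h₂ hk',
      derW_matP_basisP ε h₁ hk', dag_smul, Complex.conj_ofReal, map_add, ← map_sub]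
    congr 2
    simp only [mul_smul_comm, smul_mul_assoc, neg_mul, sub_eq_add_neg]
  rw [omegaMap_eq ε R h₁ h₂, omegaMap_eq ε R h₁ h₂, map_sum, Finset.sum_congr rfl key,
    Finset.sum_add_distrib, Finset.sum_range_sub' (fun k =>
      rho ε R (dag ε (basisP ε N p₂ k) * ξ * derW ε matP (basisP ε N p₁ k))),
    basisP_eq_zero ε h₁, derW_matP_basisP_zero ε h₁]
  simp

/-- No new computation is needed, since `2 D₀` is the commutator of `D₊` and `D₋`. -/
theorem derW_mat0_omegaMap {n r₁ r₂ : ℚ} (hr₁ : Adm n r₁) (hr₂ : Adm n r₂) (ξ : W ε) :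
    derW ε mat0 (omegaMap ε R n r₁ r₂ ξ) = omegaMap ε R n r₁ r₂ (derW ε mat0 ξ) := by
  have h := derW_matP_matM ε (omegaMap ε R n r₁ r₂ ξ)
  rw [derW_matM_omegaMap hr₁ hr₂, derW_matP_omegaMap hr₁ hr₂, derW_matP_omegaMap hr₁ hr₂,
    derW_matM_omegaMap hr₁ hr₂, derW_matP_matM, omegaMap_add, omegaMap_smul] at h
  exact (smul_right_injective (W ε) (two_ne_zero (α := ℂ)) (add_left_cancel h)).symm

/-- Each summand separately has the shifted weight: `D_K` acts on `P(n,r,m)` by `r`, and `†` changes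
the sign of this real weight. -/
theorem derW_matK_omegaMap {n r₁ r₂ : ℚ} (hr₁ : Adm n r₁) (hr₂ : Adm n r₂) (ξ : W ε) :
    derW ε matK (omegaMap ε R n r₁ r₂ ξ) =
      ((r₁ : ℂ) - (r₂ : ℂ)) • omegaMap ε R n r₁ r₂ ξ +
        omegaMap ε R n r₁ r₂ (derW ε matK ξ) := by
  obtain ⟨N, p₁, h₁, rfl, rfl⟩ := hr₁.exists_nat
  obtain ⟨N', p₂, h₂, hN, rfl⟩ := hr₂.exists_nat
  obtain rfl : N = N' := by
    have : (N : ℚ) = N' := by linarith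
    exact_mod_cast this
  rw [omegaMap_eq ε R h₁ h₂, omegaMap_eq ε R h₁ h₂, map_sum, Finset.smul_sum,
    ← Finset.sum_add_distrib]
  refine Finset.sum_congr rfl fun k _ => ?_
  have h : starRingEnd ℂ (p₂ - N / 2 : ℂ) = (p₂ - N / 2 : ℂ) := by
    simp [map_ofNat]
  rw [derW_matK_rho, derW_triple isSymplectic_matK, derW_matK_dag, derW_matK_basisP ε h₁,
    derW_matK_basisP ε h₂, dag_smul, h, ← map_smul, ← map_add]
  congr 1
  push_cast
  simp only [mul_smul_comm, smul_mul_assoc, neg_mul]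
  module

end Equivariance

/-! ### Uniqueness of highest weight vectors and the action on multiplets -/

section HighestWeight

open MvPolynomial

/-- Only `a₊` and `b₋` occur, so the derivative corrections in `Rop`, which are in `a₋` and `b₊`,
vanish and the symbol is the plain monomial. -/
theorem symb_hw (ε : ℝ) (N p : ℕ) :
    symb ε (hw ε N p) = monomial (Finsupp.single aP p + Finsupp.single bM (N - p)) 1 := by
  have h1 : symb ε (gen ε aP ^ p) = X aP ^ p := by
    induction p with
    | zero => rw [pow_zero, pow_zero, symb_one]
    | succ p ih =>
      rw [pow_succ, symb_mul_gen, ih, Rop_apply, pderiv_pow, bar, pderiv_X_of_ne (by decide),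
        mul_zero, mul_zero, sub_zero, pow_succ']
  have h2 : ∀ q, symb ε (gen ε aP ^ p * gen ε bM ^ q) = X aP ^ p * X bM ^ q := by
    intro q
    induction q with
    | zero => rw [pow_zero, pow_zero, mul_one, mul_one, h1]
    | succ q ih =>
      rw [pow_succ, ← mul_assoc, symb_mul_gen, ih, Rop_apply, pderiv_mul, pderiv_pow, pderiv_pow,
        bar, pderiv_X_of_ne (by decide), pderiv_X_of_ne (by decide)]
      ring
  rw [hw, h2, X_pow_eq_monomial, X_pow_eq_monomial, monomial_mul, mul_one]

variable {ε : ℝ}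

theorem coeff_symb_eq_zero_of_highest {w : W ε} (hw : w ∈ Psi ε) (hP : derW ε matP w = 0)
    {N : ℕ} {s : ℤ} (h0 : derW ε mat0 w = (N / 2 : ℂ) • w)
    (hK : derW ε matK w = (s - N / 2 : ℂ) • w) (m : Gen →₀ ℕ) (hm : coeff m (symb ε w) ≠ 0) :
    m aM = 0 ∧ m bP = 0 ∧ (m aP : ℤ) = s ∧ (m bM : ℤ) = N - s := by
  have h1 := (mem_Psi_iff ε w).1 hw
  have h2 : linDer matP (symb ε w) = 0 := by rw [← symb_derW, hP, map_zero]
  have h3 : linDer mat0 (symb ε w) = C (N / 2 : ℂ) * symb ε w := by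
    rw [← symb_derW, h0, map_smul, smul_eq_C_mul]
  have h4 : linDer matK (symb ε w) = C (s - N / 2 : ℂ) * symb ε w := by
    rw [← symb_derW, hK, map_smul, smul_eq_C_mul]
  obtain ⟨h5, h6, h7, h8⟩ := coeff_eq_zero_of_highest h1 h2 h3 h4 m hm
  refine ⟨h5, h6, ?_, ?_⟩
  · have : (m aP : ℂ) = s := by rw [h7]; ring
    exact_mod_cast this
  · have : (m bM : ℂ) = N - s := by rw [h8]; ring
    exact_mod_cast this

/-- The weights would force the exponent `s` of `a₊` or `N - s` of `b₋` to be negative. -/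
theorem eq_zero_of_highest {w : W ε} (hw : w ∈ Psi ε) (hP : derW ε matP w = 0)
    {N : ℕ} {s : ℤ} (h0 : derW ε mat0 w = (N / 2 : ℂ) • w)
    (hK : derW ε matK w = (s - N / 2 : ℂ) • w) (hs : s < 0 ∨ N < s) : w = 0 := by
  refine (symb_bijective ε).1 ?_
  rw [map_zero]
  ext m
  rw [coeff_zero]
  by_contra hm
  have := coeff_symb_eq_zero_of_highest hw hP h0 hK m hm
  omega

/-- Multiplicity one: the weights fix all four exponents, so the symbol has at most one nonzero
coefficient. -/
theorem eq_smul_hw_of_highest {w : W ε} (hw' : w ∈ Psi ε) (hP : derW ε matP w = 0)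
    {N p : ℕ} (hp : p ≤ N) (h0 : derW ε mat0 w = (N / 2 : ℂ) • w)
    (hK : derW ε matK w = (p - N / 2 : ℂ) • w) : ∃ c : ℂ, w = c • hw ε N p := by
  refine ⟨coeff (Finsupp.single aP p + Finsupp.single bM (N - p)) (symb ε w),
    (symb_bijective ε).1 ?_⟩
  rw [map_smul, symb_hw]
  ext m
  rw [coeff_smul, coeff_monomial, smul_eq_mul]
  split_ifs with h
  · rw [h, mul_one]
  · rw [mul_zero]
    by_contra hm
    have h1 := coeff_symb_eq_zero_of_highest (s := p) hw' hP h0 (by rw [hK]; simp) m hm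
    refine h (Finsupp.ext fun x => ?_)
    cases x <;> simp <;> omega

variable {R : ℝ}

/-- The maps `ω` act on the multiplets by shifting the weight, with a coefficient independent of
`m`. -/
theorem omegaMap_P {n r₁ r₂ : ℚ} (hr₁ : Adm n r₁) (hr₂ : Adm n r₂) {n' r : ℚ} (hr : Adm n' r) :
    ∃ c : ℂ, ∀ m : ℚ, Adm n' m →
      omegaMap ε R n r₁ r₂ (P ε n' r m) = c • P ε n' (r + r₁ - r₂) m := by
  obtain ⟨N, p, hp, rfl, rfl⟩ := hr.exists_nat
  -- The exponent of `a₊` in the target vector. It is an integer because `r₁ - r₂` is the difference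
  -- of the integers `n + r₁` and `n + r₂`.
  obtain ⟨s, hs⟩ : ∃ s : ℤ, (s : ℚ) = p + r₁ - r₂ := by
    obtain ⟨-, ⟨b₁, hb₁⟩, -⟩ := hr₁
    obtain ⟨-, ⟨b₂, hb₂⟩, -⟩ := hr₂
    exact ⟨p + b₁ - b₂, by push_cast; rw [← hb₁, ← hb₂]; ring⟩
  have hs' : (s : ℂ) = p + r₁ - r₂ := by exact_mod_cast congrArg (fun q : ℚ => (q : ℂ)) hs
  set w := omegaMap ε R n r₁ r₂ (hw ε N p) with hwdef
  have hΨ : w ∈ Psi ε := omegaMap_mem_Psi n r₁ r₂ _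
  have hP : derW ε matP w = 0 := by
    rw [hwdef, derW_matP_omegaMap hr₁ hr₂, derW_matP_hw ε hp]
    simp [omegaMap]
  have h0 : derW ε mat0 w = (N / 2 : ℂ) • w := by
    rw [hwdef, derW_mat0_omegaMap hr₁ hr₂, derW_mat0_hw ε hp, omegaMap_smul]
  have hK : derW ε matK w = (s - N / 2 : ℂ) • w := by
    rw [hwdef, derW_matK_omegaMap hr₁ hr₂, derW_matK_hw ε hp, omegaMap_smul, ← add_smul, hs']
    congr 1
    ring
  have hiter : ∀ k, omegaMap ε R n r₁ r₂ ((derW ε matM ^ k) (hw ε N p)) =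
      (derW ε matM ^ k) w := by
    intro k
    induction k with
    | zero => rfl
    | succ k ih =>
      rw [pow_succ', Module.End.mul_apply, ← derW_matM_omegaMap hr₁ hr₂, ih, ← Module.End.mul_apply]
  have hm : ∀ m : ℚ, Adm (N / 2) m → ∃ k ≤ N, m = N / 2 - k := by
    intro m hm
    obtain ⟨N', q, hq, hN, rfl⟩ := hm.exists_nat
    obtain rfl : N = N' := by
      have : (N : ℚ) = N' := by linarith
      exact_mod_cast this
    exact ⟨N - q, Nat.sub_le _ _, by rw [Nat.cast_sub hq]; ring⟩
  by_cases hsN : s < 0 ∨ N < s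
  · refine ⟨0, fun m hm' => ?_⟩
    obtain ⟨k, hk, rfl⟩ := hm m hm'
    rw [P_eq_basisP ε hp hk, basisP, omegaMap_smul, hiter,
      eq_zero_of_highest hΨ hP h0 hK hsN, map_zero, smul_zero, zero_smul]
  · push Not at hsN
    obtain ⟨hs0, hsN⟩ := hsN
    lift s to ℕ using hs0
    have hsN' : s ≤ N := by exact_mod_cast hsN
    push_cast at hK hs
    obtain ⟨c, hc⟩ := eq_smul_hw_of_highest hΨ hP hsN' h0 hK
    refine ⟨c, fun m hm' => ?_⟩
    obtain ⟨k, hk, rfl⟩ := hm m hm'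
    -- The normalizing factor of `basisP ε N p k` does not depend on `p`, so it is the same on both
    -- sides and `c` is independent of `m`.
    rw [show (p - N / 2 + r₁ - r₂ : ℚ) = s - N / 2 by rw [hs]; ring, P_eq_basisP ε hp hk,
      P_eq_basisP ε hsN' hk, basisP, basisP, omegaMap_smul, hiter, hc, map_smul, smul_comm]

end HighestWeight

/-! ### Norms within a multiplet and the value at `1` -/

section Norm

variable {ε R : ℝ}

theorem pi0_rho_derW_matP (w : W ε) : pi0 ε (rho ε R (derW ε matP w)) = 0 := by
  rw [← derW_matP_rho, pi0_derW]

/-- Apply the invariant functional `π₀ ∘ ρ` to `D₊(P_k† P_{k+1})`. The result is zero, and it is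
also the nonzero number `ladder N k` times the difference of the two norms. -/
theorem normSq_basisP_succ {N p k : ℕ} (hp : p ≤ N) (hk : k < N) :
    normSq ε R (basisP ε N p (k + 1)) = normSq ε R (basisP ε N p k) := by
  have h := pi0_rho_derW_matP (R := R) (dag ε (basisP ε N p k) * basisP ε N p (k + 1))
  rw [derW_mul ε isSymplectic_matP, derW_matP_dag, derW_matM_basisP ε hp hk.le,
    derW_matP_basisP ε hp hk.le, dag_smul, Complex.conj_ofReal, neg_mul, smul_mul_assoc,
    mul_smul_comm, ← sub_eq_add_neg, ← smul_sub, map_smul, map_smul, smul_eq_mul] at h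
  have h0 : (ladder N k : ℂ) ≠ 0 := by exact_mod_cast ladder_ne_zero hk
  have h1 := (mul_eq_zero.1 h).resolve_left h0
  rw [map_sub, map_sub, sub_eq_zero] at h1
  exact h1.symm

theorem normSq_basisP {N p k : ℕ} (hp : p ≤ N) (hk : k ≤ N) :
    normSq ε R (basisP ε N p k) = normSq ε R (basisP ε N p 0) := by
  induction k with
  | zero => rfl
  | succ k ih => rw [normSq_basisP_succ hp hk, ih (by omega)]

theorem P_zero_zero_zero : P ε 0 0 0 = 1 := by
  have h := P_eq_basisP ε (le_refl 0) (le_refl 0)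
  simpa [basisP_zero, hw] using h

/-- Since `1 = P(0,0,0)`, the action on multiplets gives a multiple of `P(0, r₁ - r₂, 0)`, which is
zero unless `r₁ = r₂`. In that case `π₀` reads off the scalar as a sum of `2n + 1` equal norms. -/
theorem omegaMap_one {n r₁ r₂ : ℚ} (hr₁ : Adm n r₁) (hr₂ : Adm n r₂) {m : ℚ} (hm : Adm n m) :
    omegaMap ε R n r₁ r₂ 1 = algebraMap ℂ (W ε)
      (if r₁ = r₂ then (2 * (n : ℂ) + 1) * normSq ε R (P ε n r₁ m) else 0) := by
  have h00 : Adm 0 0 := by simpa using adm_nat (le_refl 0)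
  obtain ⟨c, hc⟩ := omegaMap_P (ε := ε) (R := R) hr₁ hr₂ h00
  have h1 := hc 0 h00
  rw [P_zero_zero_zero, zero_add] at h1
  split_ifs with h
  · subst h
    rw [sub_self, P_zero_zero_zero] at h1
    rw [h1, Algebra.algebraMap_eq_smul_one]
    congr 1
    have h2 := congrArg (pi0 ε) h1
    rw [map_smul, pi0_one, smul_eq_mul, mul_one] at h2
    obtain ⟨N, p, hp, rfl, rfl⟩ := hr₁.exists_nat
    obtain ⟨N', q, hq, hN, rfl⟩ := hm.exists_nat
    obtain rfl : N = N' := by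
      have : (N : ℚ) = N' := by linarith
      exact_mod_cast this
    rw [show (q - N / 2 : ℚ) = N / 2 - ((N - q : ℕ) : ℚ) by rw [Nat.cast_sub hq]; ring,
      P_eq_basisP ε hp (Nat.sub_le _ _), normSq_basisP hp (Nat.sub_le _ _), ← h2,
      omegaMap_eq ε R hp hp, map_sum]
    have h3 : ∀ k ∈ Finset.range (N + 1),
        pi0 ε (rho ε R (dag ε (basisP ε N p k) * 1 * basisP ε N p k)) =
          normSq ε R (basisP ε N p 0) := by
      intro k hk
      rw [← normSq_basisP (k := k) hp (by rw [Finset.mem_range] at hk; omega), mul_one]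
      rfl
    rw [Finset.sum_congr rfl h3, Finset.sum_const, Finset.card_range, nsmul_eq_mul]
    push_cast
    ring
  · rw [h1, P, if_neg, smul_zero, map_zero]
    rintro ⟨⟨-, -, h4⟩, -⟩
    rw [abs_nonpos_iff, sub_eq_zero] at h4
    exact h h4

end Norm

end FuzzySphere

/-! ### The theorem, with the results for `derW` multiplied by `ε` -/

theorem mainTheorem7 (ε R : ℝ) (hR : 0 ≤ R) (hpos : 0 < Rhat ε R)
    (n r₁ r₂ : ℚ) (hr₁ : Adm n r₁) (hr₂ : Adm n r₂) :
    -- the map sends the space of traceless symmetric polynomials to itself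
    (∀ ξ ∈ Psi ε, omegaMap ε R n r₁ r₂ ξ ∈ Psi ε) ∧
    -- it commutes with the adjoint actions and the Laplacian
    (∀ T ∈ [Ad ε (J0 ε), Ad ε (Jp ε), Ad ε (Jm ε), Delta ε], ∀ ξ ∈ Psi ε,
      T ξ ∈ Psi ε ∧ T (omegaMap ε R n r₁ r₂ ξ) = omegaMap ε R n r₁ r₂ (T ξ)) ∧
    -- it shifts the weight
    (∀ ξ ∈ Psi ε, Ad ε (K0 ε) ξ ∈ Psi ε ∧
      Ad ε (K0 ε) (omegaMap ε R n r₁ r₂ ξ) =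
        ((ε : ℂ) * ((r₁ : ℂ) - (r₂ : ℂ))) • omegaMap ε R n r₁ r₂ ξ +
          omegaMap ε R n r₁ r₂ (Ad ε (K0 ε) ξ)) ∧
    -- basis elements (zero for indices out of range), with a coefficient independent of `m`
    (∀ n' r : ℚ, Adm n' r → ∃ c : ℂ, ∀ m : ℚ, Adm n' m →
      omegaMap ε R n r₁ r₂ (P ε n' r m) = c • P ε n' (r + r₁ - r₂) m) ∧
    -- the value at `1`
    (∀ m : ℚ, Adm n m →
      omegaMap ε R n r₁ r₂ 1 =
        algebraMap ℂ (W ε)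
          (if r₁ = r₂ then (2 * (n : ℂ) + 1) * normSq ε R (P ε n r₁ m) else 0)) := by
  have m0 : ∀ ξ ∈ Psi ε, Ad ε (J0 ε) ξ ∈ Psi ε := fun ξ hξ => by
    rw [Ad_J0]; exact (Psi ε).smul_mem _ (derW_mem_Psi ε Del_linDer_mat0 hξ)
  have mP : ∀ ξ ∈ Psi ε, Ad ε (Jp ε) ξ ∈ Psi ε := fun ξ hξ => by
    rw [Ad_Jp]; exact (Psi ε).smul_mem _ (derW_mem_Psi ε Del_linDer_matP hξ)
  have mM : ∀ ξ ∈ Psi ε, Ad ε (Jm ε) ξ ∈ Psi ε := fun ξ hξ => by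
    rw [Ad_Jm]; exact (Psi ε).smul_mem _ (derW_mem_Psi ε Del_linDer_matM hξ)
  have c0 : ∀ ξ, Ad ε (J0 ε) (omegaMap ε R n r₁ r₂ ξ) =
      omegaMap ε R n r₁ r₂ (Ad ε (J0 ε) ξ) := fun ξ => by
    rw [Ad_J0, LinearMap.smul_apply, LinearMap.smul_apply, omegaMap_smul,
      derW_mat0_omegaMap hr₁ hr₂]
  have cP : ∀ ξ, Ad ε (Jp ε) (omegaMap ε R n r₁ r₂ ξ) =
      omegaMap ε R n r₁ r₂ (Ad ε (Jp ε) ξ) := fun ξ => by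
    rw [Ad_Jp, LinearMap.smul_apply, LinearMap.smul_apply, omegaMap_smul,
      derW_matP_omegaMap hr₁ hr₂]
  have cM : ∀ ξ, Ad ε (Jm ε) (omegaMap ε R n r₁ r₂ ξ) =
      omegaMap ε R n r₁ r₂ (Ad ε (Jm ε) ξ) := fun ξ => by
    rw [Ad_Jm, LinearMap.smul_apply, LinearMap.smul_apply, omegaMap_smul,
      derW_matM_omegaMap hr₁ hr₂]
  have hΔ : ∀ w, Delta ε w = Ad ε (J0 ε) (Ad ε (J0 ε) w) +
      (1 / 2 : ℂ) • Ad ε (Jp ε) (Ad ε (Jm ε) w) +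
      (1 / 2 : ℂ) • Ad ε (Jm ε) (Ad ε (Jp ε) w) := fun w => rfl
  refine ⟨fun ξ _ => omegaMap_mem_Psi n r₁ r₂ ξ, ?_, fun ξ hξ => ⟨?_, ?_⟩,
    fun n' r hr => omegaMap_P hr₁ hr₂ hr, fun m hm => omegaMap_one hr₁ hr₂ hm⟩
  · intro T hT ξ hξ
    simp only [List.mem_cons, List.not_mem_nil, or_false] at hT
    rcases hT with rfl | rfl | rfl | rfl
    · exact ⟨m0 ξ hξ, c0 ξ⟩
    · exact ⟨mP ξ hξ, cP ξ⟩
    · exact ⟨mM ξ hξ, cM ξ⟩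
    · refine ⟨?_, ?_⟩
      · rw [hΔ]
        exact add_mem (add_mem (m0 _ (m0 _ hξ)) ((Psi ε).smul_mem _ (mP _ (mM _ hξ))))
          ((Psi ε).smul_mem _ (mM _ (mP _ hξ)))
      · simp only [hΔ, c0, cP, cM, omegaMap_add, omegaMap_smul]
  · rw [Ad_K0]; exact (Psi ε).smul_mem _ (derW_mem_Psi ε Del_linDer_matK hξ)
  · rw [Ad_K0, LinearMap.smul_apply, LinearMap.smul_apply, omegaMap_smul,
      derW_matK_omegaMap hr₁ hr₂, smul_add, smul_smul]
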